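/- Let $n\ge 1$ be an integer, $\omega\in\mathbb R\setminus\{0\}$, $\sigma\ge 1$ an integer, $a_0\in\mathcal S(\mathbb R^n)$ (complex-valued), and let $k>n/2$ be a real number. For $h>0$ consider the initial value problem $$ih\,\partial_t u^h+\frac{h^2}{2}\Delta u^h=\omega|u^h|^{2\sigma}u^h,\qquad u^h(0,x)=a_0(x),\qquad x\in\mathbb R^n,\tag{1}$$ and let $$\varphi^h(t,x)=a_0(x)\,e^{-it\omega|a_0(x)|^{2\sigma}/h},$$ which solves $ih\,\partial_t\varphi^h=\omega|\varphi^h|^{2\sigma}\varphi^h$, $\varphi^h(0,x)=a_0(x)$. Then there exist constants $c_0,c_1,\theta>0$, $C>0$ and $h_0\in(0,1)$, independent of $h$ (they may depend on $n,\omega,\sigma,a_0,k$), such that for every $h\in(0,h_0]$, with $T_h=c_0h|\ln h|^{\theta}$: the problem (1) has a solution $u^h\in C([0,T_h];H^k(\mathbb R^n))$, and every such solution satisfies $$\sup_{t\in[0,T_h]}\|u^h(t)-\varphi^h(t)\|_{H^k(\mathbb R^n)}\le C\,h\,|\ln h|^{c_1}.$$ Here $u\in C([0,T];H^k(\mathbb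 R^n))$ is called a solution of (1) if $u(0)=a_0$ and the equation holds in the sense of tempered distributions in $x$ at every $t\in[0,T]$, that is, for every $\psi\in\mathcal S(\mathbb R^n)$ and every $t\in[0,T]$ the function $t\mapsto\int u(t)\psi\,dx$ is differentiable (one-sidedly at the end points) and $ih\frac{d}{dt}\int u\,\psi\,dx+\frac{h^2}{2}\int u\,\Delta\psi\,dx=\omega\int|u|^{2\sigma}u\,\psi\,dx$. The norm of $H^k$ is defined through the Fourier transform: $\|f\|_{H^k}^2=\int(1+|\xi|^2)^k|\hat f(\xi)|^2\,d\xi$, with $\hat f(\xi)=\int e^{-2\pi i x\cdot\xi}f(x)\,dx$. -/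

import Mathlib

open MeasureTheory Set Filter Topology
open scoped SchwartzMap FourierTransform Laplacian ENNReal

namespace SemiclassicalNLS

/-- The Euclidean space `ℝⁿ`. -/
abbrev Rn (n : ℕ) : Type := EuclideanSpace ℝ (Fin n)

/-- The space `L²(ℝⁿ; ℂ)`. -/
abbrev L2 (n : ℕ) : Type := Lp ℂ 2 (volume : Measure (Rn n))

/-- The `Hˢ(ℝⁿ)` norm `(∫ (1 + |ξ|²)ˢ |f̂(ξ)|² dξ)^(1/2)` of `f ∈ L²(ℝⁿ)`, `s ≥ 0`, where `f̂` is
the Fourier transform on `L²`. It takes values in `[0, ∞]`, and `f ∈ Hˢ` iff it is finite. The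
Fourier transform is normalized with `exp (-2πi x·ξ)`, which only changes the norm into an
equivalent one. -/
noncomputable def sobolevNorm {n : ℕ} (s : ℝ) (f : L2 n) : ℝ≥0∞ :=
  (∫⁻ ξ : Rn n, ENNReal.ofReal ((1 + ‖ξ‖ ^ 2) ^ s) * ‖(𝓕 f : L2 n) ξ‖ₑ ^ 2) ^ (1 / 2 : ℝ)

/-- `u ∈ C([0,T]; Hᵏ(ℝⁿ))` solves
`i h ∂ₜ u + (h²/2) Δ u = ω |u|^(2σ) u` on `[0,T] × ℝⁿ`, with `u(0) = a₀`. The equation holds in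
the sense of tempered distributions on `ℝⁿ`, at every time `t ∈ [0,T]` (with one-sided time
derivatives at the end points): it is tested against Schwartz functions `ψ`. -/
structure IsNLSSolution {n : ℕ} (k ω : ℝ) (σ : ℕ) (h T : ℝ) (a₀ : 𝓢(Rn n, ℂ)) (u : ℝ → L2 n) :
    Prop where
  initial : u 0 = a₀.toLp 2
  mem : ∀ t ∈ Icc 0 T, sobolevNorm k (u t) < ∞
  cont : ∀ t ∈ Icc 0 T, Tendsto (fun τ => sobolevNorm k (u τ - u t)) (𝓝[Icc 0 T] t) (𝓝 0)
  equation : ∀ ψ : 𝓢(Rn n, ℂ), ∀ t ∈ Icc 0 T, ∃ D : ℂ,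
    HasDerivWithinAt (fun τ : ℝ => ∫ x, u τ x * ψ x) D (Icc 0 T) t ∧
    Complex.I * h * D + (h : ℂ) ^ 2 / 2 * ∫ x, u t x * (Δ ψ) x =
      ω * ∫ x, (‖u t x‖ : ℂ) ^ (2 * σ) * u t x * ψ x

/-- The function `φ(t,x) = a₀(x) exp (-i t ω |a₀(x)|^(2σ) / h)`. -/
noncomputable def odeFun {n : ℕ} (ω : ℝ) (σ : ℕ) (h : ℝ) (a₀ : 𝓢(Rn n, ℂ)) (t : ℝ) (x : Rn n) :
    ℂ :=
  a₀ x * Complex.exp (-Complex.I * t * ω * (‖a₀ x‖ : ℂ) ^ (2 * σ) / h)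

theorem norm_odeFun {n : ℕ} (ω : ℝ) (σ : ℕ) (h : ℝ) (a₀ : 𝓢(Rn n, ℂ)) (t : ℝ) (x : Rn n) :
    ‖odeFun ω σ h a₀ t x‖ = ‖a₀ x‖ := by
  have e : -Complex.I * t * ω * (‖a₀ x‖ : ℂ) ^ (2 * σ) / h
      = ((-(t * ω * ‖a₀ x‖ ^ (2 * σ) / h) : ℝ) : ℂ) * Complex.I := by
    push_cast; ring
  rw [odeFun, norm_mul, e, Complex.norm_exp_ofReal_mul_I, mul_one]

theorem odeFun_zero {n : ℕ} (ω : ℝ) (σ : ℕ) (h : ℝ) (a₀ : 𝓢(Rn n, ℂ)) (x : Rn n) :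
    odeFun ω σ h a₀ 0 x = a₀ x := by
  simp [odeFun]

/-- `φ` solves the ordinary differential equation `i h ∂ₜ φ = ω |φ|^(2σ) φ`. -/
theorem odeFun_ode {n : ℕ} (ω : ℝ) (σ : ℕ) (h : ℝ) (hh : h ≠ 0) (a₀ : 𝓢(Rn n, ℂ)) (t : ℝ)
    (x : Rn n) :
    ∃ D : ℂ, HasDerivAt (fun τ : ℝ => odeFun ω σ h a₀ τ x) D t ∧
      Complex.I * h * D = ω * (‖odeFun ω σ h a₀ t x‖ : ℂ) ^ (2 * σ) * odeFun ω σ h a₀ t x := by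
  have hc : (h : ℂ) ≠ 0 := by exact_mod_cast hh
  have h1 : HasDerivAt (fun τ : ℝ => -Complex.I * (τ : ℂ) * ω * (‖a₀ x‖ : ℂ) ^ (2 * σ) / h)
      (-Complex.I * 1 * ω * (‖a₀ x‖ : ℂ) ^ (2 * σ) / h) t :=
    ((((Complex.ofRealCLM.hasDerivAt (x := t)).const_mul _).mul_const _).mul_const _).div_const _
  refine ⟨_, (h1.cexp.const_mul (a₀ x)), ?_⟩
  rw [norm_odeFun, odeFun]
  field_simp
  linear_combination (-ω * (‖a₀ x‖ : ℂ) ^ (2 * σ) * a₀ x) * Complex.I_sq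

theorem memLp_odeFun {n : ℕ} (ω : ℝ) (σ : ℕ) (h : ℝ) (a₀ : 𝓢(Rn n, ℂ)) (t : ℝ) :
    MemLp (odeFun ω σ h a₀ t) 2 (volume : Measure (Rn n)) := by
  refine (a₀.memLp 2).of_le ?_ (Eventually.of_forall fun x => (norm_odeFun ω σ h a₀ t x).le)
  have : Continuous (odeFun ω σ h a₀ t) := by
    unfold odeFun
    have := a₀.continuous
    fun_prop
  exact this.aestronglyMeasurable

/-- `φ(t) = a₀ exp (-i t ω |a₀|^(2σ) / h)` as an element of `L²(ℝⁿ)`. -/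
noncomputable def odeSolution {n : ℕ} (ω : ℝ) (σ : ℕ) (h : ℝ) (a₀ : 𝓢(Rn n, ℂ)) (t : ℝ) : L2 n :=
  (memLp_odeFun ω σ h a₀ t).toLp

end SemiclassicalNLS

namespace SemiclassicalNLS

variable {n : ℕ}

/-! A function `u` in `Hᵏ` is represented by `g = (1 + |ξ|²)^(k/2) û`, so that `Hᵏ` becomes
isometric to `L²` through `toPhys`. In this representation the free Schrödinger group is
multiplication by unimodular functions (`evol`), and `|u|^(2σ) u` is an iterated weighted
convolution (`nonlin`). It is Lipschitz on balls because `Hᵏ` is an algebra for `k > n/2`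
(`norm_prod_le`, `norm_nonlin_sub_le`).

Undoing the free evolution removes the unbounded Laplacian: the distributional equation is
equivalent to an ordinary differential equation `v' = field t v` in `L²`, with `v` differentiable in
norm (`IsNLSSolution.exists_hasDerivWithinAt`, `isNLSSolution_of_hasDerivWithinAt`). Uniqueness
follows from the local Lipschitz bound. In the same picture `φ` solves this equation up to an error
of size `h ‖φ‖` in `Hᵏ⁺²` (`hasDerivWithinAt_approx`), and a truncated Picard–Lindelöf argument with
Gronwall's inequality gives an exact solution near it (`exists_ode_solution_near`).

The bounds on `φ` come from `φ(t) = exp(-i τ b) a₀` with `τ = t/h` and `b = ω |a₀|^(2σ)` a Schwartz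
function: every Sobolev norm grows at most polynomially in `τ` (`exists_norm_modulate_le`), hence
like a power of `|log h|` on the time interval considered. The Lipschitz constant is `1/h` times
such a power, and the interval has length `h` times a small power, so `θ` and `c₀` can be chosen to
make the Gronwall factor exactly `exp(|log h|/2) = h^(-1/2)`. The error accumulated without that
factor is of order `h²` up to logarithms, which leaves room for it. -/

/-! ### Sobolev weights -/

/-- The weight `(1 + |ξ|²)^(-k/2)`. -/
noncomputable def wt (k : ℝ) (ξ : Rn n) : ℝ := (1 + ‖ξ‖ ^ 2) ^ (-k / 2)

theorem one_add_norm_sq_pos (ξ : Rn n) : 0 < 1 + ‖ξ‖ ^ 2 := by positivity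

theorem wt_pos (k : ℝ) (ξ : Rn n) : 0 < wt k ξ := Real.rpow_pos_of_pos (one_add_norm_sq_pos ξ) _

theorem wt_neg (k : ℝ) (ξ : Rn n) : wt (-k) ξ = (wt k ξ)⁻¹ := by
  rw [wt, wt, ← Real.rpow_neg (one_add_norm_sq_pos ξ).le]; congr 1; ring

theorem wt_sq (k : ℝ) (ξ : Rn n) : wt k ξ ^ 2 = (1 + ‖ξ‖ ^ 2) ^ (-k) := by
  rw [wt, ← Real.rpow_natCast, ← Real.rpow_mul (one_add_norm_sq_pos ξ).le]; congr 1; push_cast; ring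

theorem wt_neg_ξ (k : ℝ) (ξ : Rn n) : wt k (-ξ) = wt k ξ := by simp [wt]

theorem continuous_wt (k : ℝ) : Continuous (wt k : Rn n → ℝ) := by
  unfold wt
  exact Continuous.rpow_const (by fun_prop) fun ξ => Or.inl (one_add_norm_sq_pos ξ).ne'

theorem wt_le_one {k : ℝ} (hk : 0 ≤ k) (ξ : Rn n) : wt k ξ ≤ 1 :=
  Real.rpow_le_one_of_one_le_of_nonpos (by nlinarith [sq_nonneg ‖ξ‖]) (by linarith)

/-- The condition `k > n/2` enters the estimates here: the algebra property and the embedding into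
continuous functions both rest on this integral. -/
theorem integrable_wt_sq {k : ℝ} (hk : (n : ℝ) / 2 < k) :
    Integrable (fun ξ : Rn n => wt k ξ ^ 2) := by
  have h := integrable_rpow_neg_one_add_norm_sq (E := Rn n) (μ := volume) (r := 2 * k)
    (by rw [finrank_euclideanSpace, Fintype.card_fin]; linarith)
  refine h.congr (Eventually.of_forall fun ξ => ?_)
  simp only [wt_sq]; congr 1; ring

theorem memLp_wt {k : ℝ} (hk : (n : ℝ) / 2 < k) :
    MemLp (fun ξ : Rn n => (wt k ξ : ℂ)) 2 volume := by
  have hm : AEStronglyMeasurable (fun ξ : Rn n => (wt k ξ : ℂ)) volume :=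
    (Complex.continuous_ofReal.comp (continuous_wt k)).aestronglyMeasurable
  rw [memLp_two_iff_integrable_sq_norm hm]
  simpa using integrable_wt_sq hk

/-! ### Multiplication operators and the `L²` norm -/

theorem enorm_sq_eq_lintegral (g : L2 n) : ‖g‖ₑ ^ 2 = ∫⁻ ξ, ‖g ξ‖ₑ ^ 2 := by
  rw [Lp.enorm_def, eLpNorm_eq_lintegral_rpow_enorm_toReal two_ne_zero ENNReal.ofNat_ne_top]
  rw [← ENNReal.rpow_natCast, ← ENNReal.rpow_mul]
  simp

theorem memLp_mul_of_le_one {m : Rn n → ℂ} (hc : Continuous m) (hb : ∀ ξ, ‖m ξ‖ ≤ 1) (g : L2 n) :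
    MemLp (fun ξ => m ξ * g ξ) 2 volume :=
  (Lp.memLp g).of_le (hc.aestronglyMeasurable.mul (Lp.aestronglyMeasurable g))
    (Eventually.of_forall fun ξ => (norm_mul (m ξ) (g ξ)).trans_le
      (mul_le_of_le_one_left (norm_nonneg _) (hb ξ)))

/-- Multiplication by a continuous function bounded by `1`, as an operator on `L²`. -/
noncomputable def mulOp (m : Rn n → ℂ) (hc : Continuous m) (hb : ∀ ξ, ‖m ξ‖ ≤ 1) :
    L2 n →L[ℂ] L2 n :=
  LinearMap.mkContinuous
    { toFun := fun g => (memLp_mul_of_le_one hc hb g).toLp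
      map_add' := fun f g => by
        rw [← MemLp.toLp_add, MemLp.toLp_eq_toLp_iff]
        filter_upwards [Lp.coeFn_add f g] with ξ h
        rw [h, Pi.add_apply, Pi.add_apply, mul_add]
      map_smul' := fun c g => by
        rw [RingHom.id_apply, ← MemLp.toLp_const_smul, MemLp.toLp_eq_toLp_iff]
        filter_upwards [Lp.coeFn_smul c g] with ξ h
        rw [h, Pi.smul_apply, Pi.smul_apply, smul_eq_mul, smul_eq_mul, mul_left_comm] }
    1 fun g => by
      rw [one_mul]
      refine Lp.norm_le_norm_of_ae_le ?_
      filter_upwards [MemLp.coeFn_toLp (memLp_mul_of_le_one hc hb g)] with ξ h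
      simp only [LinearMap.coe_mk, AddHom.coe_mk]
      rw [h, norm_mul]
      exact mul_le_of_le_one_left (norm_nonneg _) (hb ξ)

theorem mulOp_coe (m : Rn n → ℂ) (hc : Continuous m) (hb : ∀ ξ, ‖m ξ‖ ≤ 1) (g : L2 n) :
    mulOp m hc hb g =ᵐ[volume] fun ξ => m ξ * g ξ :=
  MemLp.coeFn_toLp (memLp_mul_of_le_one hc hb g)

/-! ### The product on the Fourier side -/

/-- The Fourier transform represented by the weighted function `g`. -/
noncomputable def freq (k : ℝ) (g : L2 n) (ξ : Rn n) : ℂ := wt k ξ * g ξ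

theorem measurable_freq (k : ℝ) (g : L2 n) : Measurable (freq k g) :=
  ((Complex.continuous_ofReal.comp (continuous_wt k)).measurable).mul
    (Lp.stronglyMeasurable g).measurable

/-- Cauchy–Schwarz against the square-integrable weight. It makes the inverse Fourier integral in
`phys` absolutely convergent. -/
theorem integrable_freq {k : ℝ} (hk : (n : ℝ) / 2 < k) (g : L2 n) : Integrable (freq k g) :=
  (memLp_wt hk).integrable_mul (Lp.memLp g)

theorem memLp_freq {k : ℝ} (hk : 0 ≤ k) (g : L2 n) : MemLp (freq k g) 2 volume := by
  refine (Lp.memLp g).of_le (measurable_freq k g).aestronglyMeasurable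
    (Eventually.of_forall fun ξ => ?_)
  rw [freq, norm_mul, Complex.norm_real, Real.norm_of_nonneg (wt_pos k ξ).le]
  exact mul_le_of_le_one_left (norm_nonneg _) (wt_le_one hk ξ)

theorem nonneg_of_half_lt {k : ℝ} (hk : (n : ℝ) / 2 < k) : 0 < k :=
  lt_of_le_of_lt (by positivity) hk

/-- The ratio of the weights appearing in a product. -/
noncomputable def kernel (k : ℝ) (ξ η : Rn n) : ℝ := (wt k ξ)⁻¹ * (wt k η * wt k (ξ - η))

theorem kernel_nonneg (k : ℝ) (ξ η : Rn n) : 0 ≤ kernel k ξ η := by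
  have := wt_pos k ξ; have := wt_pos k η; have := wt_pos k (ξ - η)
  unfold kernel; positivity

/-- Since `ξ = η + (ξ - η)`, the weight at `ξ` is absorbed by the larger of the weights at `η` and
`ξ - η`, and only the decay of the smaller one is left. -/
theorem kernel_sq_le {k : ℝ} (hk : 0 < k) (ξ η : Rn n) :
    kernel k ξ η ^ 2 ≤ 4 ^ k * (wt k η ^ 2 + wt k (ξ - η) ^ 2) := by
  have ha := one_add_norm_sq_pos η
  have hb := one_add_norm_sq_pos (ξ - η)
  have hc := one_add_norm_sq_pos ξ
  have h1 : kernel k ξ η ^ 2 =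
      ((1 + ‖ξ‖ ^ 2) * ((1 + ‖η‖ ^ 2)⁻¹ * (1 + ‖ξ - η‖ ^ 2)⁻¹)) ^ k := by
    rw [kernel, mul_pow, mul_pow, inv_pow, wt_sq, wt_sq, wt_sq, Real.rpow_neg hc.le, inv_inv,
      Real.mul_rpow hc.le (by positivity), Real.mul_rpow (by positivity) (by positivity),
      Real.inv_rpow ha.le, Real.inv_rpow hb.le, Real.rpow_neg ha.le, Real.rpow_neg hb.le]
  rw [h1, wt_sq, wt_sq, Real.rpow_neg ha.le, Real.rpow_neg hb.le, ← Real.inv_rpow ha.le,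
    ← Real.inv_rpow hb.le]
  set a := 1 + ‖η‖ ^ 2 with ha'
  set b := 1 + ‖ξ - η‖ ^ 2 with hb'
  have htri : 1 + ‖ξ‖ ^ 2 ≤ 2 * (a + b) := by
    have : ‖ξ‖ ≤ ‖η‖ + ‖ξ - η‖ := by
      calc ‖ξ‖ = ‖η + (ξ - η)‖ := by rw [add_sub_cancel]
        _ ≤ _ := norm_add_le _ _
    nlinarith [norm_nonneg ξ, norm_nonneg η, norm_nonneg (ξ - η), sq_nonneg (‖η‖ - ‖ξ - η‖)]
  have h2 : (1 + ‖ξ‖ ^ 2) * (a⁻¹ * b⁻¹) ≤ 4 * max a⁻¹ b⁻¹ := by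
    calc _ ≤ 2 * (a + b) * (a⁻¹ * b⁻¹) := by gcongr
      _ = 2 * (a⁻¹ + b⁻¹) := by field_simp; ring
      _ ≤ _ := by linarith [le_max_left a⁻¹ b⁻¹, le_max_right a⁻¹ b⁻¹]
  have hmax : 0 ≤ max a⁻¹ b⁻¹ := le_max_of_le_left (by positivity)
  calc _ ≤ (4 * max a⁻¹ b⁻¹) ^ k := Real.rpow_le_rpow (by positivity) h2 hk.le
    _ = 4 ^ k * (max a⁻¹ b⁻¹) ^ k := Real.mul_rpow (by norm_num) hmax
    _ ≤ _ := by
      gcongr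
      rcases max_cases a⁻¹ b⁻¹ with ⟨h, -⟩ | ⟨h, -⟩ <;> rw [h]
      · exact le_add_of_nonneg_right (by positivity)
      · exact le_add_of_nonneg_left (by positivity)

/-- A bound for the product on `Hᵏ`. -/
noncomputable def prodConst (n : ℕ) (k : ℝ) : ℝ :=
  Real.sqrt (4 ^ k * (2 * ∫ ξ : Rn n, wt k ξ ^ 2))

theorem prodConst_nonneg (k : ℝ) : 0 ≤ prodConst n k := Real.sqrt_nonneg _

theorem lintegral_kernel_sq_le {k : ℝ} (hk : (n : ℝ) / 2 < k) (ξ : Rn n) :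
    ∫⁻ η, ENNReal.ofReal (kernel k ξ η) ^ 2 ≤ ENNReal.ofReal (prodConst n k) ^ 2 := by
  have hi := integrable_wt_sq hk
  have hi' : Integrable (fun η : Rn n => wt k (ξ - η) ^ 2) := hi.comp_sub_left ξ
  have hI : 0 ≤ ∫ ξ : Rn n, wt k ξ ^ 2 := integral_nonneg fun _ => sq_nonneg _
  rw [← ENNReal.ofReal_pow (prodConst_nonneg k), prodConst, Real.sq_sqrt (by positivity)]
  calc _ ≤ ∫⁻ η, ENNReal.ofReal (4 ^ k * (wt k η ^ 2 + wt k (ξ - η) ^ 2)) := by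
        refine lintegral_mono fun η => ?_
        rw [← ENNReal.ofReal_pow (kernel_nonneg k ξ η)]
        exact ENNReal.ofReal_le_ofReal (kernel_sq_le (nonneg_of_half_lt hk) ξ η)
    _ = ENNReal.ofReal (∫ η, 4 ^ k * (wt k η ^ 2 + wt k (ξ - η) ^ 2)) := by
        have hs : Integrable fun η : Rn n => 4 ^ k * (wt k η ^ 2 + wt k (ξ - η) ^ 2) :=
          (hi.add hi').const_mul _
        rw [ofReal_integral_eq_lintegral_ofReal hs]
        · exact Eventually.of_forall fun η => by positivity
    _ = _ := by
        rw [integral_const_mul, integral_add hi hi',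
          integral_sub_left_eq_self (fun η => wt k η ^ 2) volume ξ, two_mul]

/-- The function `(1 + |ξ|²)^(k/2) (f₁ * f₂)(ξ)`, where `fᵢ` is the function represented by `gᵢ`. -/
noncomputable def prodFun (k : ℝ) (g₁ g₂ : L2 n) (ξ : Rn n) : ℂ :=
  ((wt k ξ)⁻¹ : ℝ) * ∫ η, freq k g₁ η * freq k g₂ (ξ - η)

theorem measurable_prodFun (k : ℝ) (g₁ g₂ : L2 n) : StronglyMeasurable (prodFun k g₁ g₂) := by
  refine StronglyMeasurable.mul ?_ ?_
  · exact (Complex.continuous_ofReal.comp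
      ((continuous_wt k).inv₀ fun ξ => (wt_pos k ξ).ne')).stronglyMeasurable
  · refine StronglyMeasurable.integral_prod_right
      (f := fun ξ η => freq k g₁ η * freq k g₂ (ξ - η)) ?_
    exact (((measurable_freq k g₁).comp measurable_snd).mul
      ((measurable_freq k g₂).comp (measurable_fst.sub measurable_snd))).stronglyMeasurable

/-- Cauchy–Schwarz in `η` separates the kernel, whose `L²` norm is bounded uniformly in `ξ`, from
`g₁ g₂`. -/
theorem enorm_prodFun_le {k : ℝ} (hk : (n : ℝ) / 2 < k) (g₁ g₂ : L2 n) (ξ : Rn n) :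
    ‖prodFun k g₁ g₂ ξ‖ₑ ^ 2 ≤
      ENNReal.ofReal (prodConst n k) ^ 2 * ∫⁻ η, ‖g₁ η‖ₑ ^ 2 * ‖g₂ (ξ - η)‖ₑ ^ 2 := by
  have e : prodFun k g₁ g₂ ξ = ∫ η, (kernel k ξ η : ℂ) * (g₁ η * g₂ (ξ - η)) := by
    rw [prodFun, ← integral_const_mul]
    congr 1; ext η; simp only [freq, kernel]; push_cast; ring
  have hK : Measurable fun η => ENNReal.ofReal (kernel k ξ η) := by
    have := continuous_wt (n := n) k
    refine ENNReal.measurable_ofReal.comp (Continuous.measurable ?_)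
    unfold kernel; fun_prop
  have hG : Measurable fun η => ‖g₁ η‖ₑ * ‖g₂ (ξ - η)‖ₑ :=
    (Lp.stronglyMeasurable g₁).measurable.enorm.mul
      (((Lp.stronglyMeasurable g₂).measurable.comp (measurable_const.sub measurable_id)).enorm)
  calc ‖prodFun k g₁ g₂ ξ‖ₑ ^ 2
      ≤ (∫⁻ η, ENNReal.ofReal (kernel k ξ η) * (‖g₁ η‖ₑ * ‖g₂ (ξ - η)‖ₑ)) ^ 2 := by
        rw [e]
        gcongr
        refine (enorm_integral_le_lintegral_enorm _).trans (lintegral_mono fun η => ?_)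
        rw [enorm_mul, enorm_mul, ← ofReal_norm (kernel k ξ η : ℂ), Complex.norm_real,
          Real.norm_of_nonneg (kernel_nonneg k ξ η)]
    _ ≤ (((∫⁻ η, ENNReal.ofReal (kernel k ξ η) ^ (2 : ℝ)) ^ (1 / 2 : ℝ)) *
          ((∫⁻ η, (‖g₁ η‖ₑ * ‖g₂ (ξ - η)‖ₑ) ^ (2 : ℝ)) ^ (1 / 2 : ℝ))) ^ 2 := by
        gcongr
        exact ENNReal.lintegral_mul_le_Lp_mul_Lq volume Real.HolderConjugate.two_two
          hK.aemeasurable hG.aemeasurable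
    _ = (∫⁻ η, ENNReal.ofReal (kernel k ξ η) ^ 2) * ∫⁻ η, ‖g₁ η‖ₑ ^ 2 * ‖g₂ (ξ - η)‖ₑ ^ 2 := by
        rw [mul_pow, ← ENNReal.rpow_natCast, ← ENNReal.rpow_natCast, ← ENNReal.rpow_mul,
          ← ENNReal.rpow_mul]
        norm_num [mul_pow]
    _ ≤ _ := by gcongr; exact lintegral_kernel_sq_le hk ξ

theorem lintegral_enorm_prodFun_le {k : ℝ} (hk : (n : ℝ) / 2 < k) (g₁ g₂ : L2 n) :
    ∫⁻ ξ, ‖prodFun k g₁ g₂ ξ‖ₑ ^ 2 ≤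
      (ENNReal.ofReal (prodConst n k) * (‖g₁‖ₑ * ‖g₂‖ₑ)) ^ 2 := by
  have m1 : Measurable fun η => ‖g₁ η‖ₑ ^ 2 := (Lp.stronglyMeasurable g₁).measurable.enorm.pow_const _
  have m2 : Measurable fun η => ‖g₂ η‖ₑ ^ 2 := (Lp.stronglyMeasurable g₂).measurable.enorm.pow_const _
  have m3 : Measurable fun p : Rn n × Rn n => ‖g₁ p.2‖ₑ ^ 2 * ‖g₂ (p.1 - p.2)‖ₑ ^ 2 :=
    (m1.comp measurable_snd).mul (m2.comp (measurable_fst.sub measurable_snd))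
  calc _ ≤ ∫⁻ ξ, ENNReal.ofReal (prodConst n k) ^ 2 * ∫⁻ η, ‖g₁ η‖ₑ ^ 2 * ‖g₂ (ξ - η)‖ₑ ^ 2 :=
        lintegral_mono fun ξ => enorm_prodFun_le hk g₁ g₂ ξ
    _ = ENNReal.ofReal (prodConst n k) ^ 2 *
          ∫⁻ η, ∫⁻ ξ, ‖g₁ η‖ₑ ^ 2 * ‖g₂ (ξ - η)‖ₑ ^ 2 := by
        rw [lintegral_const_mul _ m3.lintegral_prod_right']
        congr 1
        -- After Tonelli, translation invariance in `ξ` decouples the two factors.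
        exact lintegral_lintegral_swap m3.aemeasurable
    _ = _ := by
        rw [mul_pow, mul_pow, enorm_sq_eq_lintegral, enorm_sq_eq_lintegral,
          ← lintegral_mul_const _ m1]
        congr 2; ext η
        have m4 : Measurable fun ξ => ‖g₂ (ξ - η)‖ₑ ^ 2 :=
          m2.comp (measurable_id.sub measurable_const)
        rw [lintegral_const_mul _ m4]
        congr 1
        exact lintegral_sub_right_eq_self (fun ξ => ‖g₂ ξ‖ₑ ^ 2) η

theorem eLpNorm_two_eq {f : Rn n → ℂ} :
    eLpNorm f 2 volume = (∫⁻ ξ, ‖f ξ‖ₑ ^ 2) ^ (1 / 2 : ℝ) := by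
  rw [eLpNorm_eq_lintegral_rpow_enorm_toReal two_ne_zero ENNReal.ofNat_ne_top]
  simp

theorem eLpNorm_prodFun_le {k : ℝ} (hk : (n : ℝ) / 2 < k) (g₁ g₂ : L2 n) :
    eLpNorm (prodFun k g₁ g₂) 2 volume ≤
      ENNReal.ofReal (prodConst n k) * (‖g₁‖ₑ * ‖g₂‖ₑ) := by
  rw [eLpNorm_two_eq]
  calc _ ≤ ((ENNReal.ofReal (prodConst n k) * (‖g₁‖ₑ * ‖g₂‖ₑ)) ^ 2) ^ (1 / 2 : ℝ) := by
        gcongr; exact lintegral_enorm_prodFun_le hk g₁ g₂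
    _ = _ := by rw [← ENNReal.rpow_natCast, ← ENNReal.rpow_mul]; simp

theorem memLp_prodFun {k : ℝ} (hk : (n : ℝ) / 2 < k) (g₁ g₂ : L2 n) :
    MemLp (prodFun k g₁ g₂) 2 volume :=
  ⟨(measurable_prodFun k g₁ g₂).aestronglyMeasurable, (eLpNorm_prodFun_le hk g₁ g₂).trans_lt
    (ENNReal.mul_lt_top ENNReal.ofReal_lt_top (ENNReal.mul_lt_top enorm_lt_top enorm_lt_top))⟩

/-- The product of `Hᵏ`, `k > n/2`, on weighted Fourier transforms. -/
noncomputable def prod {k : ℝ} (hk : (n : ℝ) / 2 < k) (g₁ g₂ : L2 n) : L2 n :=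
  (memLp_prodFun hk g₁ g₂).toLp

theorem norm_prod_le {k : ℝ} (hk : (n : ℝ) / 2 < k) (g₁ g₂ : L2 n) :
    ‖prod hk g₁ g₂‖ ≤ prodConst n k * (‖g₁‖ * ‖g₂‖) := by
  rw [prod, Lp.norm_toLp]
  refine ENNReal.toReal_le_of_le_ofReal
    (mul_nonneg (prodConst_nonneg k) (mul_nonneg (norm_nonneg _) (norm_nonneg _))) ?_
  rw [ENNReal.ofReal_mul (prodConst_nonneg k), ENNReal.ofReal_mul (norm_nonneg _),
    ofReal_norm, ofReal_norm]
  exact eLpNorm_prodFun_le hk g₁ g₂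

/-- Both factors are in `L²`, so integrability holds at every `ξ`, not only almost everywhere, and
the convolution can be split pointwise. -/
theorem integrable_freq_mul_freq {k : ℝ} (hk : (n : ℝ) / 2 < k) (g₁ g₂ : L2 n) (ξ : Rn n) :
    Integrable fun η => freq k g₁ η * freq k g₂ (ξ - η) :=
  (memLp_freq (nonneg_of_half_lt hk).le g₁).integrable_mul
    ((memLp_freq (nonneg_of_half_lt hk).le g₂).comp_measurePreserving
      (Measure.measurePreserving_sub_left volume ξ))

theorem freq_sub_ae (k : ℝ) (f g : L2 n) :
    freq k (f - g) =ᵐ[volume] fun ξ => freq k f ξ - freq k g ξ := by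
  filter_upwards [Lp.coeFn_sub f g] with ξ h
  rw [freq, h, Pi.sub_apply, mul_sub, freq, freq]

theorem prod_sub_left {k : ℝ} (hk : (n : ℝ) / 2 < k) (f g q : L2 n) :
    prod hk (f - g) q = prod hk f q - prod hk g q := by
  rw [prod, prod, prod, ← MemLp.toLp_sub, MemLp.toLp_eq_toLp_iff]
  refine Eventually.of_forall fun ξ => ?_
  simp only [Pi.sub_apply, prodFun]
  rw [← mul_sub, ← integral_sub (integrable_freq_mul_freq hk f q ξ)
    (integrable_freq_mul_freq hk g q ξ)]
  congr 1
  refine integral_congr_ae ?_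
  filter_upwards [freq_sub_ae k f g] with η h
  rw [h, sub_mul]

theorem prod_sub_right {k : ℝ} (hk : (n : ℝ) / 2 < k) (f g q : L2 n) :
    prod hk q (f - g) = prod hk q f - prod hk q g := by
  rw [prod, prod, prod, ← MemLp.toLp_sub, MemLp.toLp_eq_toLp_iff]
  refine Eventually.of_forall fun ξ => ?_
  simp only [Pi.sub_apply, prodFun]
  rw [← mul_sub, ← integral_sub (integrable_freq_mul_freq hk q f ξ)
    (integrable_freq_mul_freq hk q g ξ)]
  congr 1
  refine integral_congr_ae ?_
  filter_upwards [(Measure.measurePreserving_sub_left volume ξ).quasiMeasurePreserving.ae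
    (freq_sub_ae k f g)] with η h
  rw [h, mul_sub]

theorem freq_prod_ae {k : ℝ} (hk : (n : ℝ) / 2 < k) (f g : L2 n) :
    freq k (prod hk f g) =ᵐ[volume]
      convolution (freq k f) (freq k g) (ContinuousLinearMap.mul ℂ ℂ) volume := by
  filter_upwards [MemLp.coeFn_toLp (memLp_prodFun hk f g)] with ξ h
  rw [freq, prod, h, prodFun, convolution, ← mul_assoc, ← Complex.ofReal_mul,
    mul_inv_cancel₀ (wt_pos k ξ).ne', Complex.ofReal_one, one_mul]
  rfl

/-! ### Conjugation -/

theorem memLp_conjFun (g : L2 n) :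
    MemLp (fun ξ => (starRingEnd ℂ) (g (-ξ))) 2 (volume : Measure (Rn n)) := by
  have h := (Lp.memLp g).comp_measurePreserving (Measure.measurePreserving_neg volume)
  refine h.of_le (Complex.continuous_conj.comp_aestronglyMeasurable h.1)
    (Eventually.of_forall fun ξ => ?_)
  simp

/-- Complex conjugation on the Fourier side. -/
noncomputable def conjOp (g : L2 n) : L2 n := (memLp_conjFun g).toLp

theorem norm_conjOp (g : L2 n) : ‖conjOp g‖ = ‖g‖ := by
  have h := Lp.norm_compMeasurePreserving g (Measure.measurePreserving_neg (volume : Measure (Rn n)))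
  rw [← h, conjOp]
  refine le_antisymm (Lp.norm_le_norm_of_ae_le ?_) (Lp.norm_le_norm_of_ae_le ?_) <;>
  · filter_upwards [MemLp.coeFn_toLp (memLp_conjFun g), Lp.coeFn_compMeasurePreserving g
      (Measure.measurePreserving_neg (volume : Measure (Rn n)))] with ξ h1 h2
    rw [h1, h2]
    simp

theorem conjOp_sub (f g : L2 n) : conjOp (f - g) = conjOp f - conjOp g := by
  rw [conjOp, conjOp, conjOp, ← MemLp.toLp_sub, MemLp.toLp_eq_toLp_iff]
  filter_upwards [(Measure.measurePreserving_neg (volume : Measure (Rn n))).quasiMeasurePreserving.ae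
    (Lp.coeFn_sub f g)] with ξ h
  rw [h, Pi.sub_apply, Pi.sub_apply, map_sub]

theorem freq_conjOp_ae (k : ℝ) (g : L2 n) :
    freq k (conjOp g) =ᵐ[volume] fun ξ => (starRingEnd ℂ) (freq k g (-ξ)) := by
  filter_upwards [MemLp.coeFn_toLp (memLp_conjFun g)] with ξ h
  simp [freq, conjOp, h, wt_neg_ξ]

/-! ### The function represented by a weighted Fourier transform -/

/-- The function on the physical side whose Fourier transform is `freq k g`. -/
noncomputable def phys (k : ℝ) (g : L2 n) (x : Rn n) : ℂ := 𝓕⁻ (freq k g) x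

theorem phys_congr {k : ℝ} {g : L2 n} {f : Rn n → ℂ} (h : freq k g =ᵐ[volume] f) (x : Rn n) :
    phys k g x = 𝓕⁻ f x := by
  rw [phys, Real.fourierInv_eq, Real.fourierInv_eq]
  refine integral_congr_ae ?_
  filter_upwards [h] with ξ h
  rw [h]

/-- The convolution theorem for integrable functions; it identifies the abstract `prod` with the
pointwise product. -/
theorem phys_prod {k : ℝ} (hk : (n : ℝ) / 2 < k) (f g : L2 n) (x : Rn n) :
    phys k (prod hk f g) x = phys k f x * phys k g x := by
  rw [phys_congr (freq_prod_ae hk f g), phys, phys]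
  simp only [Real.fourierInv_eq_fourier_neg]
  exact Real.fourier_mul_convolution_eq (integrable_freq hk f) (integrable_freq hk g) _

theorem phys_conjOp (k : ℝ) (g : L2 n) (x : Rn n) :
    phys k (conjOp g) x = (starRingEnd ℂ) (phys k g x) := by
  rw [phys_congr (freq_conjOp_ae k g), phys, Real.fourierInv_eq', Real.fourierInv_eq',
    ← integral_conj, ← integral_neg_eq_self]
  congr 1; ext ξ
  simp only [neg_neg, smul_eq_mul, map_mul, ← Complex.exp_conj, inner_neg_left, Complex.conj_I,
    Complex.conj_ofReal]
  push_cast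
  ring_nf

/-! ### The nonlinearity on the Fourier side -/

/-- The map `u ↦ |u|^(2j) u` on weighted Fourier transforms. -/
noncomputable def nonlin {k : ℝ} (hk : (n : ℝ) / 2 < k) : ℕ → L2 n → L2 n
  | 0, g => g
  | j + 1, g => prod hk (prod hk g (conjOp g)) (nonlin hk j g)

theorem phys_nonlin {k : ℝ} (hk : (n : ℝ) / 2 < k) (j : ℕ) (g : L2 n) (x : Rn n) :
    phys k (nonlin hk j g) x = (‖phys k g x‖ : ℂ) ^ (2 * j) * phys k g x := by
  induction j with
  | zero => simp [nonlin]
  | succ j ih =>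
    rw [nonlin, phys_prod, phys_prod, phys_conjOp, ih, Complex.mul_conj, Complex.normSq_eq_norm_sq]
    push_cast; ring

theorem norm_prod_conjOp_sub_le {k : ℝ} (hk : (n : ℝ) / 2 < k) {R : ℝ} {f g : L2 n}
    (hf : ‖f‖ ≤ R) (hg : ‖g‖ ≤ R) :
    ‖prod hk f (conjOp f) - prod hk g (conjOp g)‖ ≤ 2 * prodConst n k * R * ‖f - g‖ := by
  have hA := prodConst_nonneg (n := n) k
  have e : prod hk f (conjOp f) - prod hk g (conjOp g) =
      prod hk (f - g) (conjOp f) + prod hk g (conjOp (f - g)) := by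
    rw [prod_sub_left, conjOp_sub, prod_sub_right]; abel
  rw [e]
  calc _ ≤ prodConst n k * (‖f - g‖ * ‖conjOp f‖) + prodConst n k * (‖g‖ * ‖conjOp (f - g)‖) :=
        (norm_add_le _ _).trans (add_le_add (norm_prod_le hk _ _) (norm_prod_le hk _ _))
    _ ≤ prodConst n k * (‖f - g‖ * R) + prodConst n k * (R * ‖f - g‖) := by
        rw [norm_conjOp, norm_conjOp]; gcongr
    _ = _ := by ring

theorem norm_nonlin_le {k : ℝ} (hk : (n : ℝ) / 2 < k) {R : ℝ} (j : ℕ) {g : L2 n}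
    (hg : ‖g‖ ≤ R) : ‖nonlin hk j g‖ ≤ (prodConst n k * R) ^ (2 * j) * R := by
  have hA := prodConst_nonneg (n := n) k
  have hR := (norm_nonneg g).trans hg
  induction j with
  | zero => simpa [nonlin] using hg
  | succ j ih =>
    calc _ ≤ prodConst n k * (‖prod hk g (conjOp g)‖ * ‖nonlin hk j g‖) := norm_prod_le hk _ _
      _ ≤ prodConst n k * ((prodConst n k * (‖g‖ * ‖conjOp g‖)) * ‖nonlin hk j g‖) := by
          gcongr; exact norm_prod_le hk _ _
      _ ≤ prodConst n k * ((prodConst n k * (R * R)) * ((prodConst n k * R) ^ (2 * j) * R)) := by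
          rw [norm_conjOp]; gcongr
      _ = _ := by ring

/-- Telescoping: the nonlinearity is a product of `2j + 1` factors, and each contributes one
difference. -/
theorem norm_nonlin_sub_le {k : ℝ} (hk : (n : ℝ) / 2 < k) {R : ℝ} (j : ℕ) {f g : L2 n}
    (hf : ‖f‖ ≤ R) (hg : ‖g‖ ≤ R) :
    ‖nonlin hk j f - nonlin hk j g‖ ≤ (2 * j + 1) * (prodConst n k * R) ^ (2 * j) * ‖f - g‖ := by
  have hA := prodConst_nonneg (n := n) k
  have hR := (norm_nonneg g).trans hg
  induction j with
  | zero => simp [nonlin]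
  | succ j ih =>
    have e : nonlin hk (j + 1) f - nonlin hk (j + 1) g =
        prod hk (prod hk f (conjOp f) - prod hk g (conjOp g)) (nonlin hk j f) +
          prod hk (prod hk g (conjOp g)) (nonlin hk j f - nonlin hk j g) := by
      rw [prod_sub_left, prod_sub_right, nonlin, nonlin]; abel
    rw [e]
    have h1 := norm_prod_conjOp_sub_le hk hf hg
    have h2 := norm_nonlin_le hk j hf
    have h3 : ‖prod hk g (conjOp g)‖ ≤ prodConst n k * (R * R) := by
      refine (norm_prod_le hk _ _).trans ?_
      rw [norm_conjOp]; gcongr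
    calc _ ≤ prodConst n k * (‖prod hk f (conjOp f) - prod hk g (conjOp g)‖ * ‖nonlin hk j f‖) +
            prodConst n k * (‖prod hk g (conjOp g)‖ * ‖nonlin hk j f - nonlin hk j g‖) :=
          (norm_add_le _ _).trans (add_le_add (norm_prod_le hk _ _) (norm_prod_le hk _ _))
      _ ≤ prodConst n k * ((2 * prodConst n k * R * ‖f - g‖) *
              ((prodConst n k * R) ^ (2 * j) * R)) +
            prodConst n k * ((prodConst n k * (R * R)) *
              ((2 * j + 1) * (prodConst n k * R) ^ (2 * j) * ‖f - g‖)) := by gcongr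
      _ = _ := by push_cast; ring

/-! ### The isometry between weighted Fourier transforms and `Hᵏ` -/

theorem continuous_ofReal_wt (k : ℝ) : Continuous fun ξ : Rn n => (wt k ξ : ℂ) :=
  Complex.continuous_ofReal.comp (continuous_wt k)

theorem norm_ofReal_wt_le {k : ℝ} (hk : 0 ≤ k) (ξ : Rn n) : ‖(wt k ξ : ℂ)‖ ≤ 1 := by
  rw [Complex.norm_real, Real.norm_of_nonneg (wt_pos k ξ).le]; exact wt_le_one hk ξ

/-- The element of `L²` whose Fourier transform is `freq k g`. -/
noncomputable def toPhys {k : ℝ} (hk : 0 ≤ k) (g : L2 n) : L2 n :=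
  𝓕⁻ (mulOp (fun ξ => (wt k ξ : ℂ)) (continuous_ofReal_wt k) (norm_ofReal_wt_le hk) g)

theorem toPhys_sub {k : ℝ} (hk : 0 ≤ k) (f g : L2 n) :
    toPhys hk (f - g) = toPhys hk f - toPhys hk g := by
  rw [toPhys, map_sub]
  exact map_sub (FourierTransform.fourierInvCLM ℂ (L2 n)) _ _

theorem fourier_toPhys_ae {k : ℝ} (hk : 0 ≤ k) (g : L2 n) :
    (𝓕 (toPhys hk g) : L2 n) =ᵐ[volume] freq k g := by
  rw [toPhys, FourierTransform.fourier_fourierInv_eq]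
  exact mulOp_coe _ _ _ _

theorem ofReal_rpow_eq_wt_sq (k : ℝ) (ξ : Rn n) :
    ENNReal.ofReal ((1 + ‖ξ‖ ^ 2) ^ k) = ‖((wt k ξ)⁻¹ : ℝ)‖ₑ ^ 2 := by
  have := wt_pos k ξ
  rw [Real.enorm_of_nonneg (by positivity), ← ENNReal.ofReal_pow (by positivity), inv_pow, wt_sq,
    Real.rpow_neg (one_add_norm_sq_pos ξ).le, inv_inv]

theorem sobolevNorm_toPhys {k : ℝ} (hk : 0 ≤ k) (g : L2 n) :
    sobolevNorm k (toPhys hk g) = ‖g‖ₑ := by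
  rw [sobolevNorm, Lp.enorm_def, eLpNorm_two_eq]
  congr 1
  refine lintegral_congr_ae ?_
  filter_upwards [fourier_toPhys_ae hk g] with ξ h
  have hw := wt_pos k ξ
  rw [h, freq, ofReal_rpow_eq_wt_sq, ← mul_pow, enorm_mul, ← mul_assoc]
  have : ‖((wt k ξ : ℝ) : ℂ)‖ₑ = ‖wt k ξ‖ₑ := by
    rw [← ofReal_norm, ← ofReal_norm, Complex.norm_real]
  rw [this, ← enorm_mul, inv_mul_cancel₀ hw.ne', enorm_one, one_mul]

/-- Finiteness of the norm says precisely that `f̂` divided by the weight is in `L²`. -/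
theorem exists_toPhys_eq {k : ℝ} (hk : 0 ≤ k) {f : L2 n} (hf : sobolevNorm k f < ∞) :
    ∃ g : L2 n, toPhys hk g = f := by
  have e : eLpNorm (fun ξ => (((wt k ξ)⁻¹ : ℝ) : ℂ) * (𝓕 f : L2 n) ξ) 2 volume =
      sobolevNorm k f := by
    rw [sobolevNorm, eLpNorm_two_eq]
    congr 1
    refine lintegral_congr fun ξ => ?_
    rw [enorm_mul, mul_pow, ofReal_rpow_eq_wt_sq, ← ofReal_norm (((wt k ξ)⁻¹ : ℝ) : ℂ),
      Complex.norm_real, ofReal_norm]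
  have hm : MemLp (fun ξ => (((wt k ξ)⁻¹ : ℝ) : ℂ) * (𝓕 f : L2 n) ξ) 2 volume :=
    ⟨((Complex.continuous_ofReal.comp ((continuous_wt k).inv₀ fun ξ =>
      (wt_pos k ξ).ne')).aestronglyMeasurable).mul (Lp.aestronglyMeasurable _), e ▸ hf⟩
  refine ⟨hm.toLp, ?_⟩
  rw [toPhys]
  refine Eq.trans (congrArg (fun q : L2 n => (𝓕⁻ q : L2 n)) (Lp.ext ?_)) (FourierTransform.fourierInv_fourier_eq f)
  filter_upwards [mulOp_coe (fun ξ => (wt k ξ : ℂ)) (continuous_ofReal_wt k) (norm_ofReal_wt_le hk)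
    hm.toLp, MemLp.coeFn_toLp hm] with ξ h1 h2
  rw [h1, h2, ← mul_assoc, ← Complex.ofReal_mul, mul_inv_cancel₀ (wt_pos k ξ).ne',
    Complex.ofReal_one, one_mul]

theorem integral_fourierInv_mul {F : Rn n → ℂ} (hF : Integrable F) (ψ : 𝓢(Rn n, ℂ)) :
    ∫ x, 𝓕⁻ F x * ψ x = ∫ ξ, F ξ * (𝓕⁻ ψ : 𝓢(Rn n, ℂ)) ξ := by
  -- The inverse transform is the Fourier integral for the form `-⟪·,·⟫`, which is symmetric.
  have h := VectorFourier.integral_fourierIntegral_smul_eq_flip (L := -innerₗ (Rn n))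
    (μ := volume) (ν := volume) Real.continuous_fourierChar
    (continuous_inner (𝕜 := ℝ) (E := Rn n)).neg hF (ψ.integrable (μ := volume))
  simp only [smul_eq_mul] at h
  have hflip : (-innerₗ (Rn n)).flip = -innerₗ (Rn n) := by
    ext x y; simp [real_inner_comm]
  rw [hflip] at h
  rw [SchwartzMap.fourierInv_coe]
  exact h

theorem integral_toPhys_mul {k : ℝ} (hk : 0 ≤ k) (g : L2 n) (ψ : 𝓢(Rn n, ℂ)) :
    ∫ x, toPhys hk g x * ψ x = ∫ ξ, freq k g ξ * (𝓕⁻ ψ : 𝓢(Rn n, ℂ)) ξ := by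
  have h := Lp.fourierInv_toTemperedDistribution_eq
    (mulOp (fun ξ => (wt k ξ : ℂ)) (continuous_ofReal_wt k) (norm_ofReal_wt_le hk) g)
  have h2 := congrArg (fun T => T ψ) h
  simp only [TemperedDistribution.fourierInv_apply, Lp.toTemperedDistribution_apply,
    smul_eq_mul] at h2
  simp_rw [mul_comm _ (ψ _)]
  rw [toPhys, ← h2]
  refine integral_congr_ae ?_
  filter_upwards [mulOp_coe (fun ξ => (wt k ξ : ℂ)) (continuous_ofReal_wt k) (norm_ofReal_wt_le hk)
    g] with ξ h1
  rw [h1, mul_comm, freq]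

theorem ae_eq_of_integral_schwartz_eq {f g : Rn n → ℂ} (hf : LocallyIntegrable f)
    (hg : LocallyIntegrable g)
    (h : ∀ ψ : 𝓢(Rn n, ℂ), ∫ x, f x * ψ x = ∫ x, g x * ψ x) : f =ᵐ[volume] g := by
  refine ae_eq_of_integral_contDiff_smul_eq hf hg fun q hq hs => ?_
  have hs' : HasCompactSupport fun x => (q x : ℂ) := hs.comp_left (g := fun r : ℝ => (r : ℂ)) rfl
  have hq' : ContDiff ℝ (⊤ : ℕ∞) fun x => (q x : ℂ) := Complex.ofRealCLM.contDiff.comp hq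
  have := h (hs'.toSchwartzMap hq')
  simpa [mul_comm] using this

theorem continuous_phys {k : ℝ} (hk : (n : ℝ) / 2 < k) (g : L2 n) : Continuous (phys k g) := by
  have h : phys k g = fun x => 𝓕 (freq k g) (-x) := by
    ext x; rw [phys, Real.fourierInv_eq_fourier_neg]
  rw [h]
  exact (VectorFourier.fourierIntegral_continuous Real.continuous_fourierChar
    (L := innerₗ (Rn n)) continuous_inner (integrable_freq hk g)).comp continuous_neg

/-- The `L²` inverse transform and the convergent integral agree because they have the same pairings
with Schwartz functions. This gives pointwise access to `|u|^(2σ) u`. -/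
theorem toPhys_ae {k : ℝ} (hk : (n : ℝ) / 2 < k) (g : L2 n) :
    toPhys (nonneg_of_half_lt hk).le g =ᵐ[volume] phys k g := by
  refine ae_eq_of_integral_schwartz_eq ((Lp.memLp _).locallyIntegrable (by norm_num))
    (continuous_phys hk g).locallyIntegrable fun ψ => ?_
  rw [integral_toPhys_mul]
  exact (integral_fourierInv_mul (integrable_freq hk g) ψ).symm

theorem integral_nonlin_mul {k : ℝ} (hk : (n : ℝ) / 2 < k) (σ : ℕ) (g : L2 n) (ψ : 𝓢(Rn n, ℂ)) :
    ∫ x, (‖toPhys (nonneg_of_half_lt hk).le g x‖ : ℂ) ^ (2 * σ) *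
        toPhys (nonneg_of_half_lt hk).le g x * ψ x =
      ∫ ξ, freq k (nonlin hk σ g) ξ * (𝓕⁻ ψ : 𝓢(Rn n, ℂ)) ξ := by
  rw [← integral_fourierInv_mul (integrable_freq hk _) ψ]
  refine integral_congr_ae ?_
  filter_upwards [toPhys_ae hk g] with x h
  rw [h, ← phys_nonlin hk, phys]

theorem fourierInv_laplacian_apply (ψ : 𝓢(Rn n, ℂ)) (ξ : Rn n) :
    (𝓕⁻ (Δ ψ : 𝓢(Rn n, ℂ)) : 𝓢(Rn n, ℂ)) ξ =
      -(2 * Real.pi) ^ 2 * (‖ξ‖ : ℂ) ^ 2 * (𝓕⁻ ψ : 𝓢(Rn n, ℂ)) ξ := by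
  have h : (𝓕 (Δ ψ : 𝓢(Rn n, ℂ)) : 𝓢(Rn n, ℂ)) (-ξ) =
      -(2 * Real.pi) ^ 2 * (‖ξ‖ : ℂ) ^ 2 * (𝓕 ψ : 𝓢(Rn n, ℂ)) (-ξ) := by
    rw [SchwartzMap.laplacian_eq_fourierMultiplierCLM, ← SchwartzMap.fourierMultiplierCLM_ofReal ℂ
      (by fun_prop), SchwartzMap.fourierMultiplierCLM_apply, ← FourierTransform.fourierInv_smul,
      FourierTransform.fourier_fourierInv_eq, _root_.smul_apply,
      SchwartzMap.smulLeftCLM_apply_apply (by fun_prop)]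
    simp
    ring
  simp only [SchwartzMap.fourierInv_coe, SchwartzMap.fourier_coe,
    Real.fourierInv_eq_fourier_neg] at h ⊢
  exact h

/-! ### The free evolution -/

theorem norm_cexp_I_mul_norm_sq (s : ℝ) (ξ : Rn n) :
    ‖Complex.exp (Complex.I * ((s * ‖ξ‖ ^ 2 : ℝ) : ℂ))‖ = 1 := by
  rw [mul_comm]; exact Complex.norm_exp_ofReal_mul_I _

theorem continuous_cexp_norm_sq (s : ℝ) :
    Continuous fun ξ : Rn n => Complex.exp (Complex.I * ((s * ‖ξ‖ ^ 2 : ℝ) : ℂ)) := by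
  fun_prop

/-- Multiplication by `exp (i s |ξ|²)`. -/
noncomputable def evol (s : ℝ) : L2 n →L[ℂ] L2 n :=
  mulOp (fun ξ => Complex.exp (Complex.I * ((s * ‖ξ‖ ^ 2 : ℝ) : ℂ))) (continuous_cexp_norm_sq s)
    fun ξ => (norm_cexp_I_mul_norm_sq s ξ).le

theorem evol_coe (s : ℝ) (g : L2 n) :
    evol s g =ᵐ[volume] fun ξ => Complex.exp (Complex.I * ((s * ‖ξ‖ ^ 2 : ℝ) : ℂ)) * g ξ :=
  mulOp_coe _ _ _ _

theorem norm_evol (s : ℝ) (g : L2 n) : ‖evol s g‖ = ‖g‖ := by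
  refine le_antisymm (Lp.norm_le_norm_of_ae_le ?_) (Lp.norm_le_norm_of_ae_le ?_) <;>
  · filter_upwards [evol_coe s g] with ξ h
    rw [h, norm_mul, norm_cexp_I_mul_norm_sq, one_mul]

theorem evol_evol (s r : ℝ) (g : L2 n) : evol s (evol r g) = evol (s + r) g := by
  refine Lp.ext ?_
  filter_upwards [evol_coe s (evol r g), evol_coe r g, evol_coe (s + r) g] with ξ h1 h2 h3
  rw [h1, h2, h3, ← mul_assoc, ← Complex.exp_add]
  congr 2
  push_cast; ring

theorem evol_zero (g : L2 n) : evol 0 g = g := by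
  refine Lp.ext ?_
  filter_upwards [evol_coe 0 g] with ξ h
  simp [h]

theorem evol_neg_evol (s : ℝ) (g : L2 n) : evol (-s) (evol s g) = g := by
  rw [evol_evol, neg_add_cancel, evol_zero]

/-- Dominated convergence with majorant `4 |g|²`; the continuity is only strong, for fixed `g`. -/
theorem continuous_evol (g : L2 n) : Continuous fun s => evol s g := by
  rw [continuous_iff_continuousAt]
  intro s
  have h0 : Tendsto (fun τ => ‖evol τ g - evol s g‖ₑ ^ 2) (𝓝 s) (𝓝 0) := by
    have e : ∀ τ, ‖evol τ g - evol s g‖ₑ ^ 2 =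
        ∫⁻ ξ, ‖(Complex.exp (Complex.I * ((τ * ‖ξ‖ ^ 2 : ℝ) : ℂ)) -
          Complex.exp (Complex.I * ((s * ‖ξ‖ ^ 2 : ℝ) : ℂ))) * g ξ‖ₑ ^ 2 := fun τ => by
      rw [enorm_sq_eq_lintegral]
      refine lintegral_congr_ae ?_
      filter_upwards [Lp.coeFn_sub (evol τ g) (evol s g), evol_coe τ g, evol_coe s g]
        with ξ h1 h2 h3
      rw [h1, Pi.sub_apply, h2, h3, sub_mul]
    simp_rw [e]
    have hfin : ∫⁻ ξ, 4 * ‖g ξ‖ₑ ^ 2 ≠ ∞ := by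
      rw [lintegral_const_mul _ ((Lp.stronglyMeasurable g).measurable.enorm.pow_const _),
        ← enorm_sq_eq_lintegral]
      exact ENNReal.mul_ne_top (by norm_num) (ENNReal.pow_ne_top enorm_ne_top)
    have := tendsto_lintegral_filter_of_dominated_convergence (μ := volume) (l := 𝓝 s)
      (F := fun (τ : ℝ) (ξ : Rn n) => ‖(Complex.exp (Complex.I * ((τ * ‖ξ‖ ^ 2 : ℝ) : ℂ)) -
          Complex.exp (Complex.I * ((s * ‖ξ‖ ^ 2 : ℝ) : ℂ))) * g ξ‖ₑ ^ 2) (f := fun _ => 0)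
      (fun ξ => 4 * ‖g ξ‖ₑ ^ 2) ?_ ?_ hfin ?_
    · simpa using this
    · refine Eventually.of_forall fun τ => ?_
      exact ((((continuous_cexp_norm_sq τ).sub (continuous_cexp_norm_sq s)).measurable.mul
        (Lp.stronglyMeasurable g).measurable).enorm.pow_const _)
    · refine Eventually.of_forall fun τ => Eventually.of_forall fun ξ => ?_
      rw [enorm_mul, mul_pow]
      gcongr
      have : ‖Complex.exp (Complex.I * ((τ * ‖ξ‖ ^ 2 : ℝ) : ℂ)) -
          Complex.exp (Complex.I * ((s * ‖ξ‖ ^ 2 : ℝ) : ℂ))‖ₑ ≤ 2 := by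
        rw [← ofReal_norm]
        refine ENNReal.ofReal_le_of_le_toReal ((norm_sub_le _ _).trans ?_)
        rw [norm_cexp_I_mul_norm_sq, norm_cexp_I_mul_norm_sq]; norm_num
      calc _ ≤ (2 : ℝ≥0∞) ^ 2 := by gcongr
        _ = 4 := by norm_num
    · refine Eventually.of_forall fun ξ => ?_
      have hc : Continuous fun τ : ℝ => ‖(Complex.exp (Complex.I * ((τ * ‖ξ‖ ^ 2 : ℝ) : ℂ)) -
          Complex.exp (Complex.I * ((s * ‖ξ‖ ^ 2 : ℝ) : ℂ))) * g ξ‖ₑ ^ 2 := by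
        refine (ENNReal.continuous_pow 2).comp (continuous_enorm.comp ?_)
        fun_prop
      have := hc.tendsto s
      simpa using this
  have h1 := (ENNReal.continuous_rpow_const (y := 1 / 2)).tendsto 0 |>.comp h0
  have h2 : Tendsto (fun τ => ‖evol τ g - evol s g‖ₑ) (𝓝 s) (𝓝 0) := by
    refine (h1.congr fun τ => ?_).trans (by simp)
    simp only [Function.comp]
    rw [← ENNReal.rpow_natCast, ← ENNReal.rpow_mul]; simp
  rw [ContinuousAt, tendsto_iff_edist_tendsto_0]
  simpa [edist_eq_enorm_sub] using h2

theorem continuousWithinAt_evol {g : ℝ → L2 n} {a : ℝ → ℝ} {I : Set ℝ} {t : ℝ}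
    (hg : ContinuousWithinAt g I t) (ha : Continuous a) :
    ContinuousWithinAt (fun τ => evol (a τ) (g τ)) I t := by
  have h1 : Tendsto (fun τ => evol (a τ) (g τ - g t)) (𝓝[I] t) (𝓝 0) := by
    rw [tendsto_zero_iff_norm_tendsto_zero]
    simp_rw [norm_evol]
    rw [← tendsto_zero_iff_norm_tendsto_zero]
    exact tendsto_sub_nhds_zero_iff.2 hg
  have h2 : Tendsto (fun τ => evol (a τ) (g t)) (𝓝[I] t) (𝓝 (evol (a t) (g t))) :=
    (((continuous_evol (g t)).comp ha).tendsto t).mono_left nhdsWithin_le_nhds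
  have := h1.add h2
  rw [zero_add] at this
  refine this.congr fun τ => ?_
  rw [map_sub, sub_add_cancel]

/-! ### The pairing with Schwartz functions -/

/-- The bilinear pairing `∫ f g` of `L²`. -/
noncomputable def pair : L2 n →L[ℝ] L2 n →L[ℝ] ℂ :=
  (ContinuousLinearMap.mul ℝ ℂ).lpPairing volume 2 2

theorem pair_eq (f g : L2 n) : pair f g = ∫ ξ, f ξ * g ξ := by
  rw [pair, ContinuousLinearMap.lpPairing_eq_integral]; rfl

/-- No conjugation in the pairing, so the evolution moves across without a change of sign. -/
theorem pair_evol (s : ℝ) (f g : L2 n) : pair (evol s f) g = pair f (evol s g) := by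
  rw [pair_eq, pair_eq]
  refine integral_congr_ae ?_
  filter_upwards [evol_coe s f, evol_coe s g] with ξ h1 h2
  rw [h1, h2]; ring

theorem pair_smul_left (c : ℂ) (f g : L2 n) : pair (c • f) g = c * pair f g := by
  rw [pair_eq, pair_eq, ← integral_const_mul]
  refine integral_congr_ae ?_
  filter_upwards [Lp.coeFn_smul c f] with ξ h
  rw [h, Pi.smul_apply, smul_eq_mul, mul_assoc]

theorem pair_smul_right (c : ℂ) (f g : L2 n) : pair f (c • g) = c * pair f g := by
  rw [pair_eq, pair_eq, ← integral_const_mul]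
  refine integral_congr_ae ?_
  filter_upwards [Lp.coeFn_smul c g] with ξ h
  rw [h, Pi.smul_apply, smul_eq_mul, mul_left_comm]

/-- A Schwartz test function multiplied by the weight. -/
noncomputable def wtest {k : ℝ} (hk : 0 ≤ k) (χ : 𝓢(Rn n, ℂ)) : L2 n :=
  mulOp (fun ξ => (wt k ξ : ℂ)) (continuous_ofReal_wt k) (norm_ofReal_wt_le hk) (χ.toLp 2)

theorem wtest_coe {k : ℝ} (hk : 0 ≤ k) (χ : 𝓢(Rn n, ℂ)) :
    wtest hk χ =ᵐ[volume] fun ξ => wt k ξ * χ ξ := by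
  filter_upwards [mulOp_coe (fun ξ => (wt k ξ : ℂ)) (continuous_ofReal_wt k) (norm_ofReal_wt_le hk)
    (χ.toLp 2), χ.coeFn_toLp 2] with ξ h1 h2
  rw [wtest, h1, h2]

theorem pair_wtest {k : ℝ} (hk : 0 ≤ k) (g : L2 n) (χ : 𝓢(Rn n, ℂ)) :
    pair g (wtest hk χ) = ∫ ξ, freq k g ξ * χ ξ := by
  rw [pair_eq]
  refine integral_congr_ae ?_
  filter_upwards [wtest_coe hk χ] with ξ h
  rw [h, freq]; ring

theorem eq_zero_of_pair_wtest {k : ℝ} (hk : 0 ≤ k) {g : L2 n}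
    (h : ∀ χ : 𝓢(Rn n, ℂ), pair g (wtest hk χ) = 0) : g = 0 := by
  have h1 : freq k g =ᵐ[volume] fun _ => 0 := by
    refine ae_eq_of_integral_schwartz_eq ((memLp_freq hk g).locallyIntegrable (by norm_num))
      continuous_const.locallyIntegrable fun χ => ?_
    rw [← pair_wtest hk, h]; simp
  refine Lp.ext ?_
  filter_upwards [h1, Lp.coeFn_zero ℂ 2 (volume : Measure (Rn n))] with ξ h2 h3
  rw [h3, Pi.zero_apply]
  simpa [freq, (wt_pos k ξ).ne'] using h2

/-- Multiplication of a Schwartz function by `|ξ|²`. -/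
noncomputable def normSqMul (χ : 𝓢(Rn n, ℂ)) : 𝓢(Rn n, ℂ) :=
  SchwartzMap.smulLeftCLM ℂ (fun ξ : Rn n => ((‖ξ‖ ^ 2 : ℝ) : ℂ)) χ

theorem normSqMul_apply (χ : 𝓢(Rn n, ℂ)) (ξ : Rn n) : normSqMul χ ξ = ((‖ξ‖ ^ 2 : ℝ) : ℂ) * χ ξ := by
  rw [normSqMul, SchwartzMap.smulLeftCLM_apply_apply (by fun_prop), smul_eq_mul]

theorem hasTemperateGrowth_cexp_I : Function.HasTemperateGrowth
    fun x : ℝ => Complex.exp (Complex.I * x) := by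
  have hd : ∀ m : ℕ, iteratedDeriv m (fun x : ℝ => Complex.exp (Complex.I * x)) =
      fun x : ℝ => Complex.I ^ m * Complex.exp (Complex.I * x) := by
    intro m
    induction m with
    | zero => simp
    | succ m ih =>
      rw [iteratedDeriv_succ, ih]
      ext x
      have h : HasDerivAt (fun x : ℝ => Complex.I * (x : ℂ)) (Complex.I * 1) x :=
        (Complex.ofRealCLM.hasDerivAt (x := x)).const_mul _
      rw [(h.cexp.const_mul _).deriv]
      ring
  refine ⟨(contDiff_const.mul Complex.ofRealCLM.contDiff).cexp, fun m => ⟨0, 1, fun x => ?_⟩⟩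
  rw [norm_iteratedFDeriv_eq_norm_iteratedDeriv, hd, norm_mul, norm_pow, mul_comm Complex.I,
    Complex.norm_exp_ofReal_mul_I]
  simp

/-- Multiplication of a Schwartz function by `exp (i s |ξ|²)`. -/
noncomputable def evolTest (s : ℝ) (χ : 𝓢(Rn n, ℂ)) : 𝓢(Rn n, ℂ) :=
  SchwartzMap.smulLeftCLM ℂ (fun ξ : Rn n => Complex.exp (Complex.I * ((s * ‖ξ‖ ^ 2 : ℝ) : ℂ))) χ

theorem hasTemperateGrowth_cexp_norm_sq (s : ℝ) : Function.HasTemperateGrowth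
    fun ξ : Rn n => Complex.exp (Complex.I * ((s * ‖ξ‖ ^ 2 : ℝ) : ℂ)) := by
  have h : Function.HasTemperateGrowth fun ξ : Rn n => s * ‖ξ‖ ^ 2 := by fun_prop
  exact hasTemperateGrowth_cexp_I.comp h

theorem evolTest_apply (s : ℝ) (χ : 𝓢(Rn n, ℂ)) (ξ : Rn n) :
    evolTest s χ ξ = Complex.exp (Complex.I * ((s * ‖ξ‖ ^ 2 : ℝ) : ℂ)) * χ ξ := by
  rw [evolTest, SchwartzMap.smulLeftCLM_apply_apply (hasTemperateGrowth_cexp_norm_sq s),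
    smul_eq_mul]

theorem evol_wtest {k : ℝ} (hk : 0 ≤ k) (s : ℝ) (χ : 𝓢(Rn n, ℂ)) :
    evol s (wtest hk χ) = wtest hk (evolTest s χ) := by
  refine Lp.ext ?_
  filter_upwards [evol_coe s (wtest hk χ), wtest_coe hk χ, wtest_coe hk (evolTest s χ)]
    with ξ h1 h2 h3
  rw [h1, h2, h3, evolTest_apply]; ring

theorem normSqMul_evolTest (s : ℝ) (χ : 𝓢(Rn n, ℂ)) :
    normSqMul (evolTest s χ) = evolTest s (normSqMul χ) := by
  ext ξ
  rw [normSqMul_apply, evolTest_apply, evolTest_apply, normSqMul_apply]; ring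

/-- The power series handles `|x| ≤ 1`; for larger `x` each term is at most linear, hence quadratic.
-/
theorem norm_cexp_sub_one_sub_le (x : ℝ) :
    ‖Complex.exp (Complex.I * x) - 1 - Complex.I * x‖ ≤ 3 * x ^ 2 := by
  rcases le_or_gt |x| 1 with h | h
  · have := Complex.norm_exp_sub_one_sub_id_le (x := Complex.I * x) (by simpa using h)
    refine this.trans ?_
    simp only [norm_mul, Complex.norm_I, Complex.norm_real, one_mul, Real.norm_eq_abs, sq_abs]
    nlinarith [sq_nonneg x]
  · calc _ ≤ ‖Complex.exp (Complex.I * x) - 1‖ + ‖Complex.I * x‖ := norm_sub_le _ _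
      _ ≤ |x| + |x| := by
        refine add_le_add Real.norm_exp_I_mul_ofReal_sub_one_le ?_
        simp
      _ ≤ _ := by rw [← sq_abs x]; nlinarith

/-- Taylor's formula in time: each order costs a factor `|ξ|²`, which the decay of `χ` pays for. So
the free evolution is differentiable in norm on test functions. -/
theorem norm_evol_wtest_sub_le {k : ℝ} (hk : 0 ≤ k) (s τ : ℝ) (χ : 𝓢(Rn n, ℂ)) :
    ‖evol τ (wtest hk χ) - evol s (wtest hk χ) -
        (τ - s) • Complex.I • evol s (wtest hk (normSqMul χ))‖ ≤
      3 * (τ - s) ^ 2 * ‖wtest hk (normSqMul (normSqMul χ))‖ := by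
  refine Lp.norm_le_mul_norm_of_ae_le_mul ?_
  filter_upwards [Lp.coeFn_sub (evol τ (wtest hk χ) - evol s (wtest hk χ))
    ((τ - s) • Complex.I • evol s (wtest hk (normSqMul χ))),
    Lp.coeFn_sub (evol τ (wtest hk χ)) (evol s (wtest hk χ)),
    Lp.coeFn_smul (τ - s) (Complex.I • evol s (wtest hk (normSqMul χ))),
    Lp.coeFn_smul Complex.I (evol s (wtest hk (normSqMul χ))),
    evol_coe τ (wtest hk χ), evol_coe s (wtest hk χ), evol_coe s (wtest hk (normSqMul χ)),
    wtest_coe hk χ, wtest_coe hk (normSqMul χ), wtest_coe hk (normSqMul (normSqMul χ))]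
    with ξ h1 h2 h3 h4 h5 h6 h7 h8 h9 h10
  rw [h1, Pi.sub_apply, h2, Pi.sub_apply, h3, Pi.smul_apply, h4, Pi.smul_apply, h5, h6, h7, h8, h9,
    h10, normSqMul_apply, normSqMul_apply, normSqMul_apply]
  have e : Complex.exp (Complex.I * ((τ * ‖ξ‖ ^ 2 : ℝ) : ℂ)) =
      Complex.exp (Complex.I * ((s * ‖ξ‖ ^ 2 : ℝ) : ℂ)) *
        Complex.exp (Complex.I * (((τ - s) * ‖ξ‖ ^ 2 : ℝ) : ℂ)) := by
    rw [← Complex.exp_add]; congr 1; push_cast; ring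
  have e2 : Complex.exp (Complex.I * ((τ * ‖ξ‖ ^ 2 : ℝ) : ℂ)) * (wt k ξ * χ ξ) -
      Complex.exp (Complex.I * ((s * ‖ξ‖ ^ 2 : ℝ) : ℂ)) * (wt k ξ * χ ξ) -
      (τ - s) • Complex.I • (Complex.exp (Complex.I * ((s * ‖ξ‖ ^ 2 : ℝ) : ℂ)) *
        (wt k ξ * (((‖ξ‖ ^ 2 : ℝ) : ℂ) * χ ξ))) =
      Complex.exp (Complex.I * ((s * ‖ξ‖ ^ 2 : ℝ) : ℂ)) *
        (Complex.exp (Complex.I * (((τ - s) * ‖ξ‖ ^ 2 : ℝ) : ℂ)) - 1 -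
          Complex.I * (((τ - s) * ‖ξ‖ ^ 2 : ℝ) : ℂ)) * (wt k ξ * χ ξ) := by
    rw [e, smul_eq_mul, Complex.real_smul]; push_cast; ring
  rw [e2, norm_mul, norm_mul, norm_cexp_I_mul_norm_sq, one_mul, norm_mul, norm_mul, norm_mul,
    norm_mul, Complex.norm_real, Complex.norm_real, Real.norm_of_nonneg (wt_pos k ξ).le,
    Real.norm_of_nonneg (sq_nonneg ‖ξ‖)]
  have hw := (wt_pos k ξ).le
  calc _ ≤ 3 * ((τ - s) * ‖ξ‖ ^ 2) ^ 2 * (wt k ξ * ‖χ ξ‖) := by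
        gcongr; exact norm_cexp_sub_one_sub_le _
    _ = _ := by ring

theorem hasDerivAt_evol_wtest {k : ℝ} (hk : 0 ≤ k) (s : ℝ) (χ : 𝓢(Rn n, ℂ)) :
    HasDerivAt (fun τ : ℝ => evol τ (wtest hk χ))
      (Complex.I • evol s (wtest hk (normSqMul χ))) s := by
  rw [hasDerivAt_iff_isLittleO]
  have h : (fun τ : ℝ => evol τ (wtest hk χ) - evol s (wtest hk χ) -
      (τ - s) • Complex.I • evol s (wtest hk (normSqMul χ))) =O[𝓝 s] fun τ => (τ - s) ^ 2 := by
    refine Asymptotics.IsBigO.of_bound (3 * ‖wtest hk (normSqMul (normSqMul χ))‖)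
      (Eventually.of_forall fun τ => ?_)
    refine (norm_evol_wtest_sub_le hk s τ χ).trans (le_of_eq ?_)
    rw [Real.norm_of_nonneg (sq_nonneg _)]; ring
  refine h.trans_isLittleO ?_
  have := (Asymptotics.isLittleO_pow_sub_sub s (m := 2) (by norm_num))
  simpa using this

/-- Differentiation of a pairing whose second argument is differentiable, given the derivative for
the frozen second argument. -/
theorem hasDerivWithinAt_pair {y q : ℝ → L2 n} {I : Set ℝ} {s : ℝ} {D : ℂ} {q' : L2 n}
    (hy : ContinuousWithinAt y I s) (hq : HasDerivWithinAt q q' I s)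
    (hD : HasDerivWithinAt (fun τ => pair (y τ) (q s)) D I s) :
    HasDerivWithinAt (fun τ => pair (y τ) (q τ)) (D + pair (y s) q') I s := by
  have h : HasDerivWithinAt (fun τ => pair (y τ) (q τ - q s)) (pair (y s) q') I s := by
    rw [hasDerivWithinAt_iff_tendsto_slope] at hq ⊢
    -- Continuity of `y` suffices here, because the difference quotient falls on `q` and converges
    -- in norm.
    have h1 : Tendsto (fun τ => pair (y τ) (slope q s τ)) (𝓝[I \ {s}] s) (𝓝 (pair (y s) q')) := by
      have hy' : Tendsto (fun τ => pair (y τ)) (𝓝[I \ {s}] s) (𝓝 (pair (y s))) :=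
        (pair.continuous.tendsto _).comp (hy.mono_left (nhdsWithin_mono s sdiff_subset))
      exact (isBoundedBilinearMap_apply.continuous.tendsto _).comp (hy'.prodMk_nhds hq)
    refine h1.congr fun τ => ?_
    rw [slope, slope, vsub_eq_sub, vsub_eq_sub, map_smul]
    simp
  have e : (fun τ => pair (y τ) (q τ)) =
      fun τ => pair (y τ) (q s) + pair (y τ) (q τ - q s) := by
    ext τ; rw [map_sub]; ring
  rw [e]
  exact hD.fun_add h

theorem hasDerivAt_evol_mul_wtest {k : ℝ} (hk : 0 ≤ k) (c s : ℝ) (χ : 𝓢(Rn n, ℂ)) :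
    HasDerivAt (fun τ : ℝ => evol (c * τ) (wtest hk χ))
      ((Complex.I * c) • wtest hk (normSqMul (evolTest (c * s) χ))) s := by
  have h1 : HasDerivAt (fun τ : ℝ => c * τ) c s := by simpa using (hasDerivAt_id s).const_mul c
  have h := (hasDerivAt_evol_wtest hk (c * s) χ).scomp s h1
  rw [evol_wtest, ← normSqMul_evolTest] at h
  have e : (Complex.I * (c : ℂ)) • wtest hk (normSqMul (evolTest (c * s) χ)) =
      c • Complex.I • wtest hk (normSqMul (evolTest (c * s) χ)) := by
    rw [mul_comm, mul_smul]
    exact (RCLike.real_smul_eq_coe_smul (K := ℂ) c _).symm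
  rw [e]
  exact h

/-- A curve whose derivative is known when tested against Schwartz functions, is differentiable if
the weak derivative is continuous. -/
theorem hasDerivWithinAt_of_pair {k : ℝ} (hk : 0 ≤ k) {T : ℝ} {v W : ℝ → L2 n}
    (hW : ContinuousOn W (Icc 0 T))
    (hw : ∀ χ : 𝓢(Rn n, ℂ), ∀ t ∈ Icc 0 T, HasDerivWithinAt (fun τ => pair (v τ) (wtest hk χ))
      (pair (W t) (wtest hk χ)) (Icc 0 T) t) :
    ∀ t ∈ Icc 0 T, HasDerivWithinAt v (W t) (Icc 0 T) t := by
  intro t ht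
  have hT : 0 ≤ T := ht.1.trans ht.2
  -- Extending `W` by constants yields a primitive `V` differentiable in norm on the whole line; `v
  -- - V` then has zero weak derivative and vanishes at `0`.
  set W' : ℝ → L2 n := IccExtend hT (domRestrict (Icc 0 T) W) with hW'
  have hc : Continuous W' := (continuousOn_iff_continuous_domRestrict.1 hW).Icc_extend'
  have hWW : ∀ s ∈ Icc 0 T, W' s = W s := fun s hs => IccExtend_of_mem hT _ hs
  set V : ℝ → L2 n := fun s => v 0 + ∫ τ in (0 : ℝ)..s, W' τ with hV
  have hVd : ∀ s, HasDerivAt V (W' s) s := fun s =>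
    (hc.integral_hasStrictDerivAt 0 s).hasDerivAt.const_add _
  have hvV : ∀ s ∈ Icc 0 T, v s = V s := by
    intro s hs
    rw [← sub_eq_zero]
    refine eq_zero_of_pair_wtest hk fun χ => ?_
    have hd : ∀ r ∈ Icc 0 T, HasDerivWithinAt (fun τ => pair (v τ - V τ) (wtest hk χ)) 0
        (Icc 0 T) r := by
      intro r hr
      have h1 : HasDerivAt (fun τ => pair (V τ) (wtest hk χ)) (pair (W' r) (wtest hk χ)) r :=
        (pair.flip (wtest hk χ)).hasFDerivAt.comp_hasDerivAt r (hVd r)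
      have h2 := (hw χ r hr).fun_sub h1.hasDerivWithinAt
      rw [hWW r hr, sub_self] at h2
      simpa using h2
    have := constant_of_has_deriv_right_zero (fun r hr => (hd r hr).continuousWithinAt)
      (fun r hr => (hd r (Ico_subset_Icc_self hr)).mono_of_mem_nhdsWithin
        (Icc_mem_nhdsGE_of_mem hr)) s hs
    rw [this, hV]
    simp
  have := (hVd t).hasDerivWithinAt (s := Icc 0 T)
  rw [hWW t ht] at this
  exact this.congr hvV (hvV t ht)

/-- The evolution is moved onto the test function, and its time derivative there cancels the `|ξ|²`
term. What remains is a continuous weak derivative, hence a derivative in norm. -/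
theorem hasDerivWithinAt_evol_of_weak {k : ℝ} (hk : 0 ≤ k) {c T : ℝ} {y R : ℝ → L2 n}
    (hy : ContinuousOn y (Icc 0 T)) (hR : ContinuousOn R (Icc 0 T))
    (hw : ∀ χ : 𝓢(Rn n, ℂ), ∀ t ∈ Icc 0 T, HasDerivWithinAt (fun τ => pair (y τ) (wtest hk χ))
      (-(Complex.I * c) * pair (y t) (wtest hk (normSqMul χ)) + pair (R t) (wtest hk χ))
      (Icc 0 T) t) :
    ∀ t ∈ Icc 0 T,
      HasDerivWithinAt (fun τ => evol (c * τ) (y τ)) (evol (c * t) (R t)) (Icc 0 T) t := by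
  refine hasDerivWithinAt_of_pair hk
    (fun t ht => continuousWithinAt_evol (hR t ht) (continuous_const_mul c)) fun χ t ht => ?_
  simp_rw [pair_evol]
  have h1 := hw (evolTest (c * t) χ) t ht
  rw [← evol_wtest] at h1
  have h2 := hasDerivWithinAt_pair (hy t ht)
    (hasDerivAt_evol_mul_wtest hk c t χ).hasDerivWithinAt h1
  convert h2 using 1
  rw [pair_smul_right]; ring

theorem weak_of_hasDerivWithinAt_evol {k : ℝ} (hk : 0 ≤ k) {c t : ℝ} {I : Set ℝ} {v : ℝ → L2 n}
    {W : L2 n} (hv : HasDerivWithinAt v W I t) (χ : 𝓢(Rn n, ℂ)) :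
    HasDerivWithinAt (fun τ => pair (evol (-(c * τ)) (v τ)) (wtest hk χ))
      (-(Complex.I * c) * pair (evol (-(c * t)) (v t)) (wtest hk (normSqMul χ)) +
        pair (evol (-(c * t)) W) (wtest hk χ)) I t := by
  simp_rw [pair_evol, ← neg_mul]
  have h1 : HasDerivWithinAt (fun τ => pair (v τ) (evol (-c * t) (wtest hk χ)))
      (pair W (evol (-c * t) (wtest hk χ))) I t :=
    (pair.flip (evol (-c * t) (wtest hk χ))).hasFDerivAt.comp_hasDerivWithinAt t hv
  have h2 := hasDerivWithinAt_pair hv.continuousWithinAt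
    (hasDerivAt_evol_mul_wtest hk (-c) t χ).hasDerivWithinAt h1
  convert h2 using 1
  rw [pair_smul_right, evol_wtest, evol_wtest, normSqMul_evolTest]; push_cast; ring

/-! ### Ordinary differential equations near an approximate solution -/

section ODE

open scoped NNReal

variable {E : Type*} [NormedAddCommGroup E] [NormedSpace ℝ E]

/-- The radial retraction onto the ball of radius `R`. -/
noncomputable def radial (R : ℝ) (x : E) : E := (R / max R ‖x‖) • x

theorem radial_of_norm_le {R : ℝ} (hR : 0 < R) {x : E} (hx : ‖x‖ ≤ R) : radial R x = x := by
  rw [radial, max_eq_left hx, div_self hR.ne', one_smul]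

theorem norm_radial_le {R : ℝ} (hR : 0 < R) (x : E) : ‖radial R x‖ ≤ R := by
  have hm : 0 < max R ‖x‖ := lt_max_of_lt_left hR
  rw [radial, norm_smul, Real.norm_of_nonneg (by positivity), div_mul_eq_mul_div, div_le_iff₀ hm]
  gcongr
  exact le_max_right _ _

theorem norm_radial_sub_le {R : ℝ} (hR : 0 < R) (x y : E) :
    ‖radial R x - radial R y‖ ≤ 2 * ‖x - y‖ := by
  set a := max R ‖x‖ with ha
  set b := max R ‖y‖ with hb
  have ha0 : 0 < a := lt_max_of_lt_left hR
  have hb0 : 0 < b := lt_max_of_lt_left hR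
  -- Each of the two terms is at most `‖x - y‖`, whence the factor `2`, valid in any normed space.
  have e : radial R x - radial R y = (R / a) • (x - y) + (R / a - R / b) • y := by
    rw [radial, radial, smul_sub, sub_smul]; abel
  have h1 : R / a ≤ 1 := (div_le_one ha0).2 (le_max_left _ _)
  have h2 : |R / a - R / b| * ‖y‖ ≤ ‖x - y‖ := by
    have e2 : R / a - R / b = R / a * ((b - a) / b) := by field_simp
    have h3 : |b - a| ≤ ‖x - y‖ := by
      have := abs_max_sub_max_le_abs ‖y‖ ‖x‖ R
      rw [max_comm _ R, max_comm _ R] at this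
      refine this.trans ?_
      rw [norm_sub_rev]
      exact abs_norm_sub_norm_le y x
    rw [e2, abs_mul, abs_of_pos (div_pos hR ha0), abs_div, abs_of_pos hb0]
    calc R / a * (|b - a| / b) * ‖y‖ ≤ 1 * (|b - a| / b) * b := by
          gcongr; exact le_max_right _ _
      _ = |b - a| := by field_simp
      _ ≤ _ := h3
  rw [e, two_mul]
  refine (norm_add_le _ _).trans (add_le_add ?_ ?_)
  · rw [norm_smul, Real.norm_of_nonneg (by positivity)]
    exact mul_le_of_le_one_left (norm_nonneg _) h1
  · rw [norm_smul]; exact h2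

theorem gronwallBound_zero_le {K ε t : ℝ} (hK : 0 ≤ K) (hε : 0 ≤ ε) :
    gronwallBound 0 K ε t ≤ ε * t * Real.exp (K * t) := by
  rcases hK.eq_or_lt with rfl | hK
  · simp [gronwallBound_K0]
  · rw [gronwallBound_of_K_ne_0 hK.ne']
    simp only [zero_mul, zero_add]
    have h1 : Real.exp (K * t) - 1 ≤ K * t * Real.exp (K * t) := by
      have h2 := Real.add_one_le_exp (-(K * t))
      have h3 := mul_le_mul_of_nonneg_right h2 (Real.exp_pos (K * t)).le
      rw [← Real.exp_add, neg_add_cancel, Real.exp_zero] at h3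
      linarith
    calc ε / K * (Real.exp (K * t) - 1) ≤ ε / K * (K * t * Real.exp (K * t)) := by gcongr
      _ = _ := by field_simp

/-- If `p` solves the equation `x' = f(t, x)` up to a small error, then there is an exact solution
close to `p` on the whole time interval. -/
theorem exists_ode_solution_near [CompleteSpace E] {f : ℝ → E → E} {T P ε : ℝ} {K : ℝ≥0}
    {p e : ℝ → E} (hT : 0 ≤ T) (hP : 0 ≤ P) (hε : 0 ≤ ε) (hf0 : ∀ t, f t 0 = 0)
    (hcont : ∀ x, Continuous fun t => f t x)
    (hlip : ∀ t x y, ‖x‖ ≤ P + 1 → ‖y‖ ≤ P + 1 → ‖f t x - f t y‖ ≤ K * ‖x - y‖)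
    (hp : ∀ t ∈ Icc 0 T, HasDerivWithinAt p (f t (p t) + e t) (Icc 0 T) t)
    (hpP : ∀ t ∈ Icc 0 T, ‖p t‖ ≤ P) (he : ∀ t ∈ Icc 0 T, ‖e t‖ ≤ ε)
    (hsmall : ε * T * Real.exp (2 * K * T) ≤ 1) :
    ∃ v : ℝ → E, v 0 = p 0 ∧ ∀ t ∈ Icc 0 T, HasDerivWithinAt v (f t (v t)) (Icc 0 T) t ∧
      ‖v t - p t‖ ≤ ε * T * Real.exp (2 * K * T) := by
  have hR : 0 < P + 1 := by positivity
  -- The truncated field is bounded and globally Lipschitz, so its solution exists on all of `[0,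
  -- T]`.
  set F : ℝ → E → E := fun t x => f t (radial (P + 1) x) with hF
  have hFlip : ∀ t, LipschitzWith (2 * K) (F t) := fun t => by
    refine LipschitzWith.of_dist_le_mul fun x y => ?_
    rw [dist_eq_norm, dist_eq_norm]
    calc _ ≤ K * ‖radial (P + 1) x - radial (P + 1) y‖ :=
          hlip t _ _ (norm_radial_le hR x) (norm_radial_le hR y)
      _ ≤ K * (2 * ‖x - y‖) := by gcongr; exact norm_radial_sub_le hR x y
      _ = _ := by push_cast; ring
  have hFp : ∀ t x, ‖x‖ ≤ P + 1 → F t x = f t x := fun t x hx => by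
    rw [hF]; simp only; rw [radial_of_norm_le hR hx]
  have hPL : IsPicardLindelof F (⟨0, left_mem_Icc.2 hT⟩ : Icc 0 T) (p 0)
      -- The radius is the bound of the field times `T`, so it imposes no restriction on `T`.
      ((K * (P + 1).toNNReal) * T.toNNReal) 0 (K * (P + 1).toNNReal) (2 * K) :=
    { lipschitzOnWith := fun t _ => (hFlip t).lipschitzOnWith
      continuousOn := fun x _ => (hcont _).continuousOn
      norm_le := fun t _ x _ => by
        have h := hlip t (radial (P + 1) x) 0 (norm_radial_le hR x) (by simpa using hR.le)
        rw [hf0, sub_zero, sub_zero] at h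
        refine h.trans ?_
        rw [NNReal.coe_mul, Real.coe_toNNReal _ hR.le]
        gcongr
        exact norm_radial_le hR x
      mul_max_le := by simp [hT] }
  obtain ⟨v, hv0, hv⟩ := hPL.exists_eq_forall_mem_Icc_hasDerivWithinAt₀
  have right : ∀ {g : ℝ → E} {g' : E} {t : ℝ}, t ∈ Ico 0 T → HasDerivWithinAt g g' (Icc 0 T) t →
      HasDerivWithinAt g g' (Ici t) t := fun ht h =>
    h.mono_of_mem_nhdsWithin (Icc_mem_nhdsGE_of_mem ht)
  have hdist : ∀ t ∈ Icc 0 T, ‖v t - p t‖ ≤ ε * T * Real.exp (2 * K * T) := by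
    intro t ht
    have h := dist_le_of_approx_trajectories_ODE (v := F) (K := 2 * K) (εf := 0) (εg := ε) (δ := 0)
      (f := v) (g := p) hFlip (fun s hs => (hv s hs).continuousWithinAt)
      (fun s hs => right hs (hv s (Ico_subset_Icc_self hs))) (fun s _ => (dist_self _).le)
      (fun s hs => (hp s hs).continuousWithinAt)
      (fun s hs => right hs (hp s (Ico_subset_Icc_self hs)))
      (fun s hs => by
        have hs' := Ico_subset_Icc_self hs
        rw [hFp s _ ((hpP s hs').trans (by linarith)), dist_eq_norm, add_sub_cancel_left]
        exact he s hs')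
      (by rw [dist_le_zero]; exact hv0) t ht
    rw [dist_eq_norm, zero_add, sub_zero] at h
    refine h.trans ((gronwallBound_zero_le (by positivity) hε).trans ?_)
    push_cast
    gcongr
    · exact ht.2
    · exact ht.2
  refine ⟨v, hv0, fun t ht => ⟨?_, hdist t ht⟩⟩
  -- A posteriori the solution stays where truncation has no effect: `p` is within `P`, and `hsmall`
  -- bounds the deviation by `1`.
  have hvn : ‖v t‖ ≤ P + 1 := by
    calc ‖v t‖ = ‖p t + (v t - p t)‖ := by rw [add_sub_cancel]
      _ ≤ ‖p t‖ + ‖v t - p t‖ := norm_add_le _ _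
      _ ≤ _ := add_le_add (hpP t ht) ((hdist t ht).trans hsmall)
  have := hv t ht
  rwa [hFp t _ hvn] at this

/-- Uniqueness for an equation whose vector field is Lipschitz on every ball. -/
theorem ode_solution_unique_of_lipschitz_on_balls {f : ℝ → E → E} {T : ℝ} {v w : ℝ → E}
    (hlip : ∀ R : ℝ, 0 ≤ R → ∃ K : ℝ≥0, ∀ t x y, ‖x‖ ≤ R → ‖y‖ ≤ R →
      ‖f t x - f t y‖ ≤ K * ‖x - y‖)
    (hv : ∀ t ∈ Icc 0 T, HasDerivWithinAt v (f t (v t)) (Icc 0 T) t)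
    (hw : ∀ t ∈ Icc 0 T, HasDerivWithinAt w (f t (w t)) (Icc 0 T) t) (h0 : v 0 = w 0) :
    EqOn v w (Icc 0 T) := by
  have hvc : ContinuousOn v (Icc 0 T) := fun s hs => (hv s hs).continuousWithinAt
  have hwc : ContinuousOn w (Icc 0 T) := fun s hs => (hw s hs).continuousWithinAt
  obtain ⟨Rv, hRv⟩ := isCompact_Icc.exists_bound_of_continuousOn hvc
  obtain ⟨Rw, hRw⟩ := isCompact_Icc.exists_bound_of_continuousOn hwc
  -- By compactness of `[0, T]` both curves lie in one ball, where a single Lipschitz constant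
  -- applies.
  obtain ⟨K, hK⟩ := hlip (max 0 (max Rv Rw)) (le_max_left _ _)
  have right : ∀ {g : ℝ → E} {g' : E} {t : ℝ}, t ∈ Ico 0 T → HasDerivWithinAt g g' (Icc 0 T) t →
      HasDerivWithinAt g g' (Ici t) t := fun ht h =>
    h.mono_of_mem_nhdsWithin (Icc_mem_nhdsGE_of_mem ht)
  refine ODE_solution_unique_of_mem_Icc_right (v := f) (K := K)
    (s := fun _ => {x | ‖x‖ ≤ max 0 (max Rv Rw)}) (fun t _ => ?_) hvc
    (fun s hs => right hs (hv s (Ico_subset_Icc_self hs))) (fun s hs => ?_) hwc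
    (fun s hs => right hs (hw s (Ico_subset_Icc_self hs))) (fun s hs => ?_) h0
  · refine LipschitzOnWith.of_dist_le_mul fun x hx y hy => ?_
    rw [dist_eq_norm, dist_eq_norm]
    exact hK t x y hx hy
  · exact (hRv s (Ico_subset_Icc_self hs)).trans ((le_max_left _ _).trans (le_max_right _ _))
  · exact (hRw s (Ico_subset_Icc_self hs)).trans ((le_max_right _ _).trans (le_max_right _ _))

end ODE

/-! ### The equation in the interaction picture -/

/-- The speed of the phases of the free evolution. -/
noncomputable def freeSpeed (h : ℝ) : ℝ := 2 * Real.pi ^ 2 * h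

/-- The nonlinear term of the equation divided by `i h`. -/
noncomputable def scaledNonlin {k : ℝ} (hk : (n : ℝ) / 2 < k) (ω : ℝ) (σ : ℕ) (h : ℝ) (g : L2 n) :
    L2 n :=
  (-(Complex.I * ω / h) : ℂ) • nonlin hk σ g

/-- The vector field of the equation in the interaction picture. -/
noncomputable def field {k : ℝ} (hk : (n : ℝ) / 2 < k) (ω : ℝ) (σ : ℕ) (h t : ℝ) (g : L2 n) :
    L2 n :=
  evol (freeSpeed h * t) (scaledNonlin hk ω σ h (evol (-(freeSpeed h * t)) g))

theorem norm_scaledNonlin_sub_le {k : ℝ} (hk : (n : ℝ) / 2 < k) (ω : ℝ) (σ : ℕ) {h : ℝ}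
    (hh : 0 < h) {R : ℝ} {f g : L2 n} (hf : ‖f‖ ≤ R) (hg : ‖g‖ ≤ R) :
    ‖scaledNonlin hk ω σ h f - scaledNonlin hk ω σ h g‖ ≤
      |ω| / h * ((2 * σ + 1) * (prodConst n k * R) ^ (2 * σ)) * ‖f - g‖ := by
  rw [scaledNonlin, scaledNonlin, ← smul_sub, norm_smul, mul_assoc]
  have e : ‖(-(Complex.I * ω / h) : ℂ)‖ = |ω| / h := by
    simp [abs_of_pos hh]
  rw [e]
  gcongr
  exact norm_nonlin_sub_le hk σ hf hg

theorem norm_field_sub_le {k : ℝ} (hk : (n : ℝ) / 2 < k) (ω : ℝ) (σ : ℕ) {h : ℝ}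
    (hh : 0 < h) (t : ℝ) {R : ℝ} {f g : L2 n} (hf : ‖f‖ ≤ R) (hg : ‖g‖ ≤ R) :
    ‖field hk ω σ h t f - field hk ω σ h t g‖ ≤
      |ω| / h * ((2 * σ + 1) * (prodConst n k * R) ^ (2 * σ)) * ‖f - g‖ := by
  rw [field, field, ← map_sub, norm_evol]
  have := norm_scaledNonlin_sub_le hk ω σ hh (f := evol (-(freeSpeed h * t)) f)
    (g := evol (-(freeSpeed h * t)) g) (R := R) (by rwa [norm_evol]) (by rwa [norm_evol])
  rwa [← map_sub, norm_evol] at this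

theorem norm_nonlin_zero {k : ℝ} (hk : (n : ℝ) / 2 < k) (σ : ℕ) : nonlin hk σ (0 : L2 n) = 0 := by
  have := norm_nonlin_le hk (R := 0) σ (g := (0 : L2 n)) (by simp)
  simpa using this

theorem field_zero {k : ℝ} (hk : (n : ℝ) / 2 < k) (ω : ℝ) (σ : ℕ) (h t : ℝ) :
    field hk ω σ h t (0 : L2 n) = 0 := by
  rw [field, map_zero, scaledNonlin, norm_nonlin_zero, smul_zero, map_zero]

theorem continuous_scaledNonlin {k : ℝ} (hk : (n : ℝ) / 2 < k) (ω : ℝ) (σ : ℕ) {h : ℝ}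
    (hh : 0 < h) : Continuous (scaledNonlin hk ω σ h) := by
  rw [continuous_iff_continuousAt]
  intro g
  refine ContinuousOn.continuousAt (s := Metric.ball 0 (‖g‖ + 1)) ?_
    (Metric.isOpen_ball.mem_nhds (by simp))
  refine LipschitzOnWith.continuousOn (K := (|ω| / h * ((2 * σ + 1) *
    (prodConst n k * (‖g‖ + 1)) ^ (2 * σ))).toNNReal) ?_
  refine LipschitzOnWith.of_dist_le_mul fun x hx y hy => ?_
  rw [Real.coe_toNNReal _ (by have := prodConst_nonneg (n := n) k; positivity), dist_eq_norm,
    dist_eq_norm]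
  exact norm_scaledNonlin_sub_le hk ω σ hh (mem_ball_zero_iff.1 hx).le (mem_ball_zero_iff.1 hy).le

theorem continuous_field {k : ℝ} (hk : (n : ℝ) / 2 < k) (ω : ℝ) (σ : ℕ) {h : ℝ} (hh : 0 < h)
    (g : L2 n) : Continuous fun t => field hk ω σ h t g := by
  have h1 : Continuous fun t : ℝ => scaledNonlin hk ω σ h (evol (-(freeSpeed h * t)) g) :=
    (continuous_scaledNonlin hk ω σ hh).comp
      ((continuous_evol g).comp (by fun_prop : Continuous fun t : ℝ => -(freeSpeed h * t)))
  rw [← continuousOn_univ]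
  intro t _
  exact continuousWithinAt_evol h1.continuousWithinAt (continuous_const_mul _)

theorem fourierInv_laplacian (ψ : 𝓢(Rn n, ℂ)) :
    (𝓕⁻ (Δ ψ : 𝓢(Rn n, ℂ)) : 𝓢(Rn n, ℂ)) =
      (-(2 * Real.pi) ^ 2 : ℂ) • normSqMul (𝓕⁻ ψ : 𝓢(Rn n, ℂ)) := by
  ext ξ
  rw [fourierInv_laplacian_apply, _root_.smul_apply, normSqMul_apply, smul_eq_mul]
  push_cast; ring

theorem integral_toPhys_mul_eq_pair {k : ℝ} (hk : 0 ≤ k) (g : L2 n) (ψ : 𝓢(Rn n, ℂ)) :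
    ∫ x, toPhys hk g x * ψ x = pair g (wtest hk (𝓕⁻ ψ : 𝓢(Rn n, ℂ))) := by
  rw [integral_toPhys_mul, pair_wtest]

theorem integral_toPhys_mul_laplacian {k : ℝ} (hk : 0 ≤ k) (g : L2 n) (ψ : 𝓢(Rn n, ℂ)) :
    ∫ x, toPhys hk g x * (Δ ψ) x =
      -(2 * Real.pi) ^ 2 * pair g (wtest hk (normSqMul (𝓕⁻ ψ : 𝓢(Rn n, ℂ)))) := by
  rw [integral_toPhys_mul, fourierInv_laplacian, pair_wtest, ← integral_const_mul]
  congr 1; ext ξ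
  rw [_root_.smul_apply, smul_eq_mul]; ring

/-- Division by `i h` on the Fourier side: the symbol `4π² |ξ|²` times `h²/2`, divided by `h`,
produces the speed `2π² h`. -/
theorem nls_iff_pair {k : ℝ} (hk : (n : ℝ) / 2 < k) (ω : ℝ) (σ : ℕ) {h : ℝ} (hh : 0 < h)
    (g : L2 n) (ψ : 𝓢(Rn n, ℂ)) (D : ℂ) :
    (Complex.I * h * D + (h : ℂ) ^ 2 / 2 *
        ∫ x, toPhys (nonneg_of_half_lt hk).le g x * (Δ ψ) x =
      ω * ∫ x, (‖toPhys (nonneg_of_half_lt hk).le g x‖ : ℂ) ^ (2 * σ) *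
        toPhys (nonneg_of_half_lt hk).le g x * ψ x) ↔
    D = -(Complex.I * (freeSpeed h : ℝ)) *
        pair g (wtest (nonneg_of_half_lt hk).le (normSqMul (𝓕⁻ ψ : 𝓢(Rn n, ℂ)))) +
      pair (scaledNonlin hk ω σ h g)
        (wtest (nonneg_of_half_lt hk).le (𝓕⁻ ψ : 𝓢(Rn n, ℂ))) := by
  rw [integral_nonlin_mul, integral_toPhys_mul_laplacian, scaledNonlin, pair_smul_left,
    ← pair_wtest (nonneg_of_half_lt hk).le]
  swap
  · exact hk
  have hc : (h : ℂ) ≠ 0 := by exact_mod_cast hh.ne'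
  set X := pair g (wtest (nonneg_of_half_lt hk).le (normSqMul (𝓕⁻ ψ : 𝓢(Rn n, ℂ))))
  set Y := pair (nonlin hk σ g) (wtest (nonneg_of_half_lt hk).le (𝓕⁻ ψ : 𝓢(Rn n, ℂ)))
  have hI := Complex.I_sq
  have e : ∀ D : ℂ, Complex.I * h * D + (h : ℂ) ^ 2 / 2 * (-(2 * Real.pi) ^ 2 * X) - ω * Y =
      Complex.I * h * (D - (-(Complex.I * (freeSpeed h : ℝ)) * X + -(Complex.I * ω / h) * Y)) := by
    intro D
    rw [freeSpeed]
    push_cast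
    field_simp
    linear_combination (-(2 * (Real.pi : ℂ) ^ 2 * h ^ 2 * X) - ω * Y) * hI
  rw [← sub_eq_zero, e, ← sub_eq_zero (a := D)]
  simp [hc]

theorem continuousWithinAt_of_sobolevNorm {k : ℝ} (hk : 0 ≤ k) {y : ℝ → L2 n} {I : Set ℝ} {t : ℝ}
    (h : Tendsto (fun τ => sobolevNorm k (toPhys hk (y τ) - toPhys hk (y t))) (𝓝[I] t) (𝓝 0)) :
    ContinuousWithinAt y I t := by
  rw [ContinuousWithinAt, tendsto_iff_edist_tendsto_0]
  refine h.congr fun τ => ?_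
  rw [← toPhys_sub, sobolevNorm_toPhys, edist_eq_enorm_sub]

/-- A solution of the equation solves, in the interaction picture, an ordinary differential
equation. -/
theorem IsNLSSolution.exists_hasDerivWithinAt {k : ℝ} (hk : (n : ℝ) / 2 < k) {ω : ℝ} {σ : ℕ}
    {h T : ℝ} (hh : 0 < h) {a₀ : 𝓢(Rn n, ℂ)} {u : ℝ → L2 n} (hu : IsNLSSolution k ω σ h T a₀ u) :
    ∃ v : ℝ → L2 n,
      (∀ t ∈ Icc 0 T, toPhys (nonneg_of_half_lt hk).le (evol (-(freeSpeed h * t)) (v t)) = u t) ∧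
      ∀ t ∈ Icc 0 T, HasDerivWithinAt v (field hk ω σ h t (v t)) (Icc 0 T) t := by
  set hk0 := (nonneg_of_half_lt hk).le
  choose! y hy using fun t (ht : t ∈ Icc 0 T) => exists_toPhys_eq hk0 (hu.mem t ht)
  have hyc : ContinuousOn y (Icc 0 T) := fun t ht => by
    refine continuousWithinAt_of_sobolevNorm hk0 ((hu.cont t ht).congr' ?_)
    filter_upwards [self_mem_nhdsWithin] with τ hτ
    rw [hy τ hτ, hy t ht]
  refine ⟨fun t => evol (freeSpeed h * t) (y t), fun t ht => ?_, fun t ht => ?_⟩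
  · rw [evol_neg_evol]; exact hy t ht
  · rw [field, evol_neg_evol]
    refine hasDerivWithinAt_evol_of_weak hk0 hyc
      ((continuous_scaledNonlin hk ω σ hh).comp_continuousOn hyc) (fun χ s hs => ?_) t ht
    -- Testing with `𝓕 χ` makes the test function on the frequency side the arbitrary `χ`.
    obtain ⟨D, hD, hDe⟩ := hu.equation (𝓕 χ : 𝓢(Rn n, ℂ)) s hs
    rw [← hy s hs, nls_iff_pair hk ω σ hh, FourierTransform.fourierInv_fourier_eq] at hDe
    rw [Function.comp_apply, ← hDe]
    refine hD.congr (fun τ hτ => ?_) ?_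
    · rw [← hy τ hτ, integral_toPhys_mul_eq_pair, FourierTransform.fourierInv_fourier_eq]
    · rw [← hy s hs, integral_toPhys_mul_eq_pair, FourierTransform.fourierInv_fourier_eq]

theorem isNLSSolution_of_hasDerivWithinAt {k : ℝ} (hk : (n : ℝ) / 2 < k) {ω : ℝ} {σ : ℕ}
    {h T : ℝ} (hh : 0 < h) {a₀ : 𝓢(Rn n, ℂ)} {v : ℝ → L2 n}
    (h0 : toPhys (nonneg_of_half_lt hk).le (v 0) = a₀.toLp 2)
    (hv : ∀ t ∈ Icc 0 T, HasDerivWithinAt v (field hk ω σ h t (v t)) (Icc 0 T) t) :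
    IsNLSSolution k ω σ h T a₀
      fun t => toPhys (nonneg_of_half_lt hk).le (evol (-(freeSpeed h * t)) (v t)) where
  initial := by simp only [mul_zero, neg_zero, evol_zero, h0]
  mem t _ := by rw [sobolevNorm_toPhys]; exact enorm_lt_top
  cont t ht := by
    have := continuousWithinAt_evol (hv t ht).continuousWithinAt
      (by fun_prop : Continuous fun t : ℝ => -(freeSpeed h * t))
    rw [ContinuousWithinAt, tendsto_iff_edist_tendsto_0] at this
    refine this.congr fun τ => ?_
    rw [← toPhys_sub, sobolevNorm_toPhys, edist_eq_enorm_sub]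
  equation ψ t ht := by
    have h1 := weak_of_hasDerivWithinAt_evol (nonneg_of_half_lt hk).le (c := freeSpeed h) (hv t ht)
      (𝓕⁻ ψ : 𝓢(Rn n, ℂ))
    rw [field, evol_neg_evol] at h1
    simp_rw [← integral_toPhys_mul_eq_pair] at h1
    exact ⟨_, h1, (nls_iff_pair hk ω σ hh _ ψ _).2
      (by rw [integral_toPhys_mul_eq_pair])⟩

/-! ### Schwartz functions with an oscillating phase -/

/-- A continuous linear map on Schwartz functions, applied to `G a`, is controlled by finitely many
derivatives of the multiplier `G`. -/
theorem exists_norm_smulLeftCLM_le (L : 𝓢(Rn n, ℂ) →L[ℂ] L2 n) (a : 𝓢(Rn n, ℂ)) :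
    ∃ (N : ℕ) (C : ℝ), 0 ≤ C ∧ ∀ (G : Rn n → ℂ) (K : ℝ), G.HasTemperateGrowth →
      (∀ i ≤ N, ∀ x, ‖iteratedFDeriv ℝ i G x‖ ≤ K) →
      ‖L (SchwartzMap.smulLeftCLM ℂ G a)‖ ≤ C * K := by
  -- Continuity involves finitely many Schwartz seminorms. In each, Leibniz's rule puts the
  -- polynomial weight on `a`, so only unweighted derivatives of `G` occur; `N` is the highest
  -- order.
  obtain ⟨s, C, -, hC⟩ := Seminorm.bound_of_continuous (schwartz_withSeminorms ℂ (Rn n) ℂ)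
    ((normSeminorm ℂ (L2 n)).comp (L : 𝓢(Rn n, ℂ) →ₗ[ℂ] L2 n)) (continuous_norm.comp L.continuous)
  set M : ℕ × ℕ → ℝ := fun m => ∑ i ∈ Finset.range (m.2 + 1),
    (m.2.choose i : ℝ) * SchwartzMap.seminorm ℂ m.1 (m.2 - i) a with hM
  have hM0 : ∀ m, 0 ≤ M m := fun m => Finset.sum_nonneg fun i _ =>
    mul_nonneg (Nat.cast_nonneg _) (apply_nonneg _ _)
  refine ⟨s.sup fun m => m.2, C * ∑ m ∈ s, M m,
    mul_nonneg C.2 (Finset.sum_nonneg fun m _ => hM0 m), fun G K hG hK => ?_⟩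
  have hK0 : 0 ≤ K := (norm_nonneg _).trans (hK 0 (Nat.zero_le _) 0)
  have hsem : ∀ m ∈ s, schwartzSeminormFamily ℂ (Rn n) ℂ m (SchwartzMap.smulLeftCLM ℂ G a) ≤
      M m * K := by
    intro m hm
    refine SchwartzMap.seminorm_le_bound ℂ m.1 m.2 _ (mul_nonneg (hM0 m) hK0) fun x => ?_
    rw [SchwartzMap.smulLeftCLM_apply hG]
    calc ‖x‖ ^ m.1 * ‖iteratedFDeriv ℝ m.2 (fun y => G y • a y) x‖
        ≤ ‖x‖ ^ m.1 * ∑ i ∈ Finset.range (m.2 + 1), (m.2.choose i : ℝ) *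
            ‖iteratedFDeriv ℝ i G x‖ * ‖iteratedFDeriv ℝ (m.2 - i) a x‖ := by
          gcongr
          exact norm_iteratedFDeriv_smul_le hG.1 (a.smooth ⊤) x (by exact_mod_cast le_top)
      _ = ∑ i ∈ Finset.range (m.2 + 1), (m.2.choose i : ℝ) * ‖iteratedFDeriv ℝ i G x‖ *
            (‖x‖ ^ m.1 * ‖iteratedFDeriv ℝ (m.2 - i) a x‖) := by
          rw [Finset.mul_sum]; refine Finset.sum_congr rfl fun i _ => ?_; ring
      _ ≤ ∑ i ∈ Finset.range (m.2 + 1), (m.2.choose i : ℝ) * K *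
            SchwartzMap.seminorm ℂ m.1 (m.2 - i) a := by
          refine Finset.sum_le_sum fun i hi => ?_
          gcongr
          · exact hK i ((Nat.lt_succ_iff.1 (Finset.mem_range.1 hi)).trans
              (Finset.le_sup (f := fun m : ℕ × ℕ => m.2) hm)) x
          · exact SchwartzMap.le_seminorm ℂ m.1 _ a x
      _ = M m * K := by
          rw [hM, Finset.sum_mul]; refine Finset.sum_congr rfl fun i _ => ?_; ring
  calc ‖L (SchwartzMap.smulLeftCLM ℂ G a)‖
      ≤ C * (s.sup (schwartzSeminormFamily ℂ (Rn n) ℂ)) (SchwartzMap.smulLeftCLM ℂ G a) := hC _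
    _ ≤ C * ∑ m ∈ s, M m * K := by
        gcongr
        have h0 : ∀ m ∈ s, 0 ≤ M m * K := fun m _ => mul_nonneg (hM0 m) hK0
        exact Seminorm.finset_sup_apply_le (Finset.sum_nonneg h0) fun m hm =>
          (hsem m hm).trans (Finset.single_le_sum h0 hm)
    _ = _ := by rw [← Finset.sum_mul, mul_assoc]

/-- The phase factor `exp (-i τ y)`. -/
noncomputable def phase (τ y : ℝ) : ℂ := Complex.exp (-(Complex.I * τ) * y)

theorem norm_phase (τ y : ℝ) : ‖phase τ y‖ = 1 := by
  have : -(Complex.I * τ) * y = ((-(τ * y) : ℝ) : ℂ) * Complex.I := by push_cast; ring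
  rw [phase, this, Complex.norm_exp_ofReal_mul_I]

theorem contDiff_phase (τ : ℝ) (m : WithTop ℕ∞) : ContDiff ℝ m (phase τ) :=
  (contDiff_const.mul Complex.ofRealCLM.contDiff).cexp

theorem iteratedDeriv_phase (m : ℕ) (τ : ℝ) :
    iteratedDeriv m (phase τ) = fun y => (-(Complex.I * τ)) ^ m * phase τ y := by
  induction m with
  | zero => simp
  | succ m ih =>
    rw [iteratedDeriv_succ, ih]
    ext y
    have h : HasDerivAt (fun y : ℝ => -(Complex.I * τ) * (y : ℂ)) (-(Complex.I * τ) * 1) y :=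
      (Complex.ofRealCLM.hasDerivAt (x := y)).const_mul _
    have h2 : HasDerivAt (fun y => (-(Complex.I * τ)) ^ m * phase τ y)
      ((-(Complex.I * τ)) ^ m * (phase τ y * (-(Complex.I * τ) * 1))) y := h.cexp.const_mul _
    rw [h2.deriv]
    ring

theorem hasTemperateGrowth_phase (τ : ℝ) : (phase τ).HasTemperateGrowth := by
  refine ⟨contDiff_phase τ _, fun m => ⟨0, |τ| ^ m, fun x => ?_⟩⟩
  rw [norm_iteratedFDeriv_eq_norm_iteratedDeriv, iteratedDeriv_phase, norm_mul, norm_phase]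
  simp

theorem norm_phase_sub_le (τ s y : ℝ) : ‖phase τ y - phase s y‖ ≤ |τ - s| * |y| := by
  have e : phase τ y - phase s y =
      phase s y * (Complex.exp (Complex.I * ((-((τ - s) * y) : ℝ) : ℂ)) - 1) := by
    rw [mul_sub, mul_one, phase, phase, ← Complex.exp_add]
    congr 2; push_cast; ring
  rw [e, norm_mul, norm_phase, one_mul]
  refine Real.norm_exp_I_mul_ofReal_sub_one_le.trans ?_
  rw [Real.norm_eq_abs, abs_neg, abs_mul]

/-- The modulated function `exp (-i τ b) a`. -/
noncomputable def modulate (b : 𝓢(Rn n, ℝ)) (a : 𝓢(Rn n, ℂ)) (τ : ℝ) : 𝓢(Rn n, ℂ) :=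
  SchwartzMap.smulLeftCLM ℂ (phase τ ∘ b) a

theorem hasTemperateGrowth_phase_comp (b : 𝓢(Rn n, ℝ)) (τ : ℝ) :
    (phase τ ∘ b).HasTemperateGrowth :=
  (hasTemperateGrowth_phase τ).comp b.hasTemperateGrowth

theorem modulate_apply (b : 𝓢(Rn n, ℝ)) (a : 𝓢(Rn n, ℂ)) (τ : ℝ) (x : Rn n) :
    modulate b a τ x = phase τ (b x) * a x := by
  rw [modulate, SchwartzMap.smulLeftCLM_apply_apply (hasTemperateGrowth_phase_comp b τ)]; rfl

theorem exists_iteratedFDeriv_le (b : 𝓢(Rn n, ℝ)) (N : ℕ) :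
    ∃ B : ℝ, 1 ≤ B ∧ ∀ i ≤ N, ∀ x, ‖iteratedFDeriv ℝ i b x‖ ≤ B := by
  refine ⟨1 + ∑ i ∈ Finset.range (N + 1), SchwartzMap.seminorm ℝ 0 i b,
    le_add_of_nonneg_right (Finset.sum_nonneg fun i _ => apply_nonneg _ _), fun i hi x => ?_⟩
  calc _ ≤ SchwartzMap.seminorm ℝ 0 i b := SchwartzMap.norm_iteratedFDeriv_le_seminorm ℝ b i x
    _ ≤ ∑ i ∈ Finset.range (N + 1), SchwartzMap.seminorm ℝ 0 i b :=
        Finset.single_le_sum (f := fun i => SchwartzMap.seminorm ℝ 0 i b)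
          (fun i _ => apply_nonneg _ _) (Finset.mem_range.2 (Nat.lt_succ_of_le hi))
    _ ≤ _ := le_add_of_nonneg_left zero_le_one

/-- Faà di Bruno's formula; `1 ≤ B` lets powers of `B` dominate the derivatives of `b` of every
order. -/
theorem norm_iteratedFDeriv_comp_le_of_bounds (b : 𝓢(Rn n, ℝ)) {N : ℕ} {B C : ℝ} (hB : 1 ≤ B)
    (hb : ∀ i ≤ N, ∀ x, ‖iteratedFDeriv ℝ i b x‖ ≤ B) {g : ℝ → ℂ} (hg : ContDiff ℝ (⊤ : ℕ∞) g)
    (hC : ∀ i ≤ N, ∀ x, ‖iteratedDeriv i g (b x)‖ ≤ C) :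
    ∀ i ≤ N, ∀ x, ‖iteratedFDeriv ℝ i (g ∘ b) x‖ ≤ N.factorial * C * B ^ N := by
  intro i hi x
  have hC0 : 0 ≤ C := (norm_nonneg _).trans (hC 0 (Nat.zero_le _) x)
  calc _ ≤ i.factorial * C * B ^ i := by
        refine norm_iteratedFDeriv_comp_le hg (b.smooth ⊤) (by exact_mod_cast le_top) x
          (fun j hj => ?_) (fun j hj1 hj => ?_)
        · rw [norm_iteratedFDeriv_eq_norm_iteratedDeriv]; exact hC j (hj.trans hi) x
        · exact (hb j (hj.trans hi) x).trans (le_self_pow₀ hB (by omega))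
    _ ≤ _ := by gcongr

/-- Each derivative of `y ↦ exp(-i τ y)` brings one factor `τ` and leaves the modulus at one, so the
growth is polynomial. -/
theorem exists_norm_modulate_le (L : 𝓢(Rn n, ℂ) →L[ℂ] L2 n) (b : 𝓢(Rn n, ℝ)) (a : 𝓢(Rn n, ℂ)) :
    ∃ (N : ℕ) (C : ℝ), 0 ≤ C ∧ ∀ τ, ‖L (modulate b a τ)‖ ≤ C * (1 + |τ|) ^ N := by
  obtain ⟨N, C, hC, h⟩ := exists_norm_smulLeftCLM_le L a
  obtain ⟨B, hB, hb⟩ := exists_iteratedFDeriv_le b N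
  refine ⟨N, C * (N.factorial * B ^ N), by positivity, fun τ => ?_⟩
  refine (h _ _ (hasTemperateGrowth_phase_comp b τ) (norm_iteratedFDeriv_comp_le_of_bounds b hB hb
    (contDiff_phase τ _) (C := (1 + |τ|) ^ N) fun i hi x => ?_)).trans (le_of_eq (by ring))
  rw [iteratedDeriv_phase, norm_mul, norm_phase, norm_pow, norm_neg, norm_mul, Complex.norm_I,
    Complex.norm_real, Real.norm_eq_abs, one_mul, mul_one]
  calc |τ| ^ i ≤ (1 + |τ|) ^ i := by gcongr; linarith
    _ ≤ _ := pow_le_pow_right₀ (by linarith [abs_nonneg τ]) hi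

theorem continuous_modulate (L : 𝓢(Rn n, ℂ) →L[ℂ] L2 n) (b : 𝓢(Rn n, ℝ)) (a : 𝓢(Rn n, ℂ)) :
    Continuous fun τ => L (modulate b a τ) := by
  obtain ⟨N, C, hC, h⟩ := exists_norm_smulLeftCLM_le L a
  obtain ⟨B, hB, hb⟩ := exists_iteratedFDeriv_le b N
  rw [continuous_iff_continuousAt]
  intro s
  -- A modulus of continuity at `s`, bounding all derivatives of `phase τ - phase s` up to order `N`
  -- on the range of `b`.
  set c : ℝ → ℝ := fun τ => ∑ i ∈ Finset.range (N + 1),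
    (|τ - s| * B * |τ| ^ i + ‖(-(Complex.I * τ)) ^ i - (-(Complex.I * s)) ^ i‖) with hc
  have hcc : Continuous c := by rw [hc]; fun_prop
  have hc0 : c s = 0 := by rw [hc]; simp
  have hle : ∀ τ, ‖L (modulate b a τ) - L (modulate b a s)‖ ≤
      C * (N.factorial * c τ * B ^ N) := by
    intro τ
    have e : L (modulate b a τ) - L (modulate b a s) =
        L (SchwartzMap.smulLeftCLM ℂ ((phase τ - phase s) ∘ b) a) := by
      rw [← map_sub]
      congr 1
      ext x
      rw [_root_.sub_apply, modulate_apply, modulate_apply, SchwartzMap.smulLeftCLM_apply_apply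
        (((hasTemperateGrowth_phase τ).sub (hasTemperateGrowth_phase s)).comp
          b.hasTemperateGrowth)]
      simp [sub_mul]
    rw [e]
    refine h _ _ (((hasTemperateGrowth_phase τ).sub (hasTemperateGrowth_phase s)).comp
          b.hasTemperateGrowth) (norm_iteratedFDeriv_comp_le_of_bounds b hB hb
      ((contDiff_phase τ _).sub (contDiff_phase s _)) fun i hi x => ?_)
    rw [iteratedDeriv_sub ((contDiff_phase τ _).contDiffAt) ((contDiff_phase s _).contDiffAt),
      iteratedDeriv_phase, iteratedDeriv_phase]
    have e2 : (-(Complex.I * τ)) ^ i * phase τ (b x) - (-(Complex.I * s)) ^ i * phase s (b x) =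
        (-(Complex.I * τ)) ^ i * (phase τ (b x) - phase s (b x)) +
          ((-(Complex.I * τ)) ^ i - (-(Complex.I * s)) ^ i) * phase s (b x) := by ring
    have hbx : |b x| ≤ B := by
      have := hb 0 (Nat.zero_le _) x
      rwa [norm_iteratedFDeriv_zero, Real.norm_eq_abs] at this
    calc _ ≤ |τ - s| * B * |τ| ^ i +
          ‖(-(Complex.I * τ)) ^ i - (-(Complex.I * s)) ^ i‖ := by
          rw [e2]
          refine (norm_add_le _ _).trans (add_le_add ?_ ?_)
          · rw [norm_mul, norm_pow, norm_neg, norm_mul, Complex.norm_I, Complex.norm_real,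
              Real.norm_eq_abs, one_mul, mul_comm]
            gcongr
            exact (norm_phase_sub_le τ s (b x)).trans (by gcongr)
          · rw [norm_mul, norm_phase, mul_one]
      _ ≤ c τ := by
          rw [hc]
          exact Finset.single_le_sum (f := fun i => |τ - s| * B * |τ| ^ i +
            ‖(-(Complex.I * τ)) ^ i - (-(Complex.I * s)) ^ i‖) (fun i _ => by positivity)
            (Finset.mem_range.2 (Nat.lt_succ_of_le hi))
  rw [ContinuousAt, tendsto_iff_norm_sub_tendsto_zero]
  refine squeeze_zero (fun τ => norm_nonneg _) hle ?_
  have : Continuous fun τ => C * (N.factorial * c τ * B ^ N) := by fun_prop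
  have := this.tendsto s
  rwa [hc0, mul_zero, zero_mul, mul_zero] at this

/-! ### The weighted Fourier transform of Schwartz functions -/

theorem hasTemperateGrowth_wt (k : ℝ) :
    Function.HasTemperateGrowth fun ξ : Rn n => ((wt k ξ : ℝ) : ℂ) := by
  unfold wt
  exact Function.Complex.hasTemperateGrowth_ofReal.comp (Function.hasTemperateGrowth_one_add_norm_sq_rpow (Rn n) (-k / 2))

/-- Division of a Schwartz function by the weight, as an element of `L²`. -/
noncomputable def unweight (n : ℕ) (k : ℝ) : 𝓢(Rn n, ℂ) →L[ℂ] L2 n :=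
  SchwartzMap.toLpCLM ℂ ℂ 2 volume ∘L
    SchwartzMap.smulLeftCLM ℂ (fun ξ : Rn n => ((wt (-k) ξ : ℝ) : ℂ))

/-- The weighted Fourier transform of a Schwartz function. -/
noncomputable def weighted (n : ℕ) (k : ℝ) : 𝓢(Rn n, ℂ) →L[ℂ] L2 n :=
  unweight n k ∘L FourierTransform.fourierCLM ℂ 𝓢(Rn n, ℂ)

/-- The weighted Fourier transform of `-Δψ / (4π²)`. -/
noncomputable def weightedNormSq (n : ℕ) (k : ℝ) : 𝓢(Rn n, ℂ) →L[ℂ] L2 n :=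
  unweight n k ∘L SchwartzMap.smulLeftCLM ℂ (fun ξ : Rn n => ((‖ξ‖ ^ 2 : ℝ) : ℂ)) ∘L
    FourierTransform.fourierCLM ℂ 𝓢(Rn n, ℂ)

theorem weighted_apply (k : ℝ) (ψ : 𝓢(Rn n, ℂ)) :
    weighted n k ψ = unweight n k (𝓕 ψ : 𝓢(Rn n, ℂ)) := rfl

theorem weightedNormSq_apply (k : ℝ) (ψ : 𝓢(Rn n, ℂ)) :
    weightedNormSq n k ψ = unweight n k (normSqMul (𝓕 ψ : 𝓢(Rn n, ℂ))) := rfl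

theorem freq_unweight_ae (k : ℝ) (χ : 𝓢(Rn n, ℂ)) : freq k (unweight n k χ) =ᵐ[volume] χ := by
  filter_upwards [(SchwartzMap.smulLeftCLM ℂ
    (fun ξ : Rn n => ((wt (-k) ξ : ℝ) : ℂ)) χ).coeFn_toLp 2 volume] with ξ h
  have e : unweight n k χ = (SchwartzMap.smulLeftCLM ℂ
    (fun ξ : Rn n => ((wt (-k) ξ : ℝ) : ℂ)) χ).toLp 2 volume := rfl
  rw [freq, e, h, SchwartzMap.smulLeftCLM_apply_apply (hasTemperateGrowth_wt _), wt_neg,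
    smul_eq_mul, ← mul_assoc, ← Complex.ofReal_mul, mul_inv_cancel₀ (wt_pos k ξ).ne',
    Complex.ofReal_one, one_mul]

theorem toPhys_weighted {k : ℝ} (hk : 0 ≤ k) (ψ : 𝓢(Rn n, ℂ)) :
    toPhys hk (weighted n k ψ) = ψ.toLp 2 := by
  have h : mulOp (fun ξ => (wt k ξ : ℂ)) (continuous_ofReal_wt k) (norm_ofReal_wt_le hk)
      (weighted n k ψ) = (𝓕 ψ : 𝓢(Rn n, ℂ)).toLp 2 := by
    refine Lp.ext ?_
    filter_upwards [mulOp_coe (fun ξ => (wt k ξ : ℂ)) (continuous_ofReal_wt k)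
      (norm_ofReal_wt_le hk) (weighted n k ψ), freq_unweight_ae k (𝓕 ψ : 𝓢(Rn n, ℂ)),
      (𝓕 ψ : 𝓢(Rn n, ℂ)).coeFn_toLp 2 volume] with ξ h1 h2 h3
    rw [h1, h3, ← h2]; rfl
  rw [toPhys, h, SchwartzMap.toLp_fourierInv_eq, FourierTransform.fourierInv_fourier_eq]

theorem pair_weightedNormSq {k : ℝ} (hk : 0 ≤ k) (ψ χ : 𝓢(Rn n, ℂ)) :
    pair (weightedNormSq n k ψ) (wtest hk χ) = pair (weighted n k ψ) (wtest hk (normSqMul χ)) := by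
  rw [pair_wtest, pair_wtest]
  refine integral_congr_ae ?_
  filter_upwards [freq_unweight_ae k (𝓕 ψ : 𝓢(Rn n, ℂ)),
    freq_unweight_ae k (normSqMul (𝓕 ψ : 𝓢(Rn n, ℂ)))] with ξ h1 h2
  rw [weightedNormSq_apply, weighted_apply, h1, h2, normSqMul_apply, normSqMul_apply]; ring

/-! ### The solution of the ordinary differential equation as an approximate solution -/

/-- For `σ ≥ 1`, `|a₀|^(2σ)` factors as `(conj a₀)^σ a₀^(σ-1)`, of temperate growth, times the
Schwartz function `a₀`. Smoothness of the modulus is never needed. -/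
theorem exists_potential (ω : ℝ) {σ : ℕ} (hσ : 0 < σ) (a₀ : 𝓢(Rn n, ℂ)) :
    ∃ b : 𝓢(Rn n, ℝ), ∀ x, b x = ω * ‖a₀ x‖ ^ (2 * σ) := by
  have h1 : Function.HasTemperateGrowth fun x => (starRingEnd ℂ) (a₀ x) :=
    (Complex.conjCLE.toContinuousLinearMap.hasTemperateGrowth).comp a₀.hasTemperateGrowth
  have h2 : Function.HasTemperateGrowth (a₀ : Rn n → ℂ) := a₀.hasTemperateGrowth
  have h3 : Function.HasTemperateGrowth fun x =>
      (ω : ℂ) * ((starRingEnd ℂ) (a₀ x) ^ σ * a₀ x ^ (σ - 1)) := by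
    fun_prop
  refine ⟨SchwartzMap.postcompCLM (𝕜 := ℝ) Complex.reCLM (SchwartzMap.smulLeftCLM ℂ (fun x =>
    (ω : ℂ) * ((starRingEnd ℂ) (a₀ x) ^ σ * a₀ x ^ (σ - 1))) a₀), fun x => ?_⟩
  rw [SchwartzMap.postcompCLM_apply, SchwartzMap.smulLeftCLM_apply_apply h3, smul_eq_mul]
  have e : (ω : ℂ) * ((starRingEnd ℂ) (a₀ x) ^ σ * a₀ x ^ (σ - 1)) * a₀ x =
      ((ω * ‖a₀ x‖ ^ (2 * σ) : ℝ) : ℂ) := by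
    rw [mul_assoc, mul_assoc, ← pow_succ, Nat.sub_add_cancel hσ, ← mul_pow, mul_comm _ (a₀ x),
      Complex.mul_conj, Complex.normSq_eq_norm_sq]
    push_cast
    rw [pow_mul]
  rw [e]
  exact Complex.ofReal_re _

theorem modulate_eq_odeFun {ω : ℝ} {σ : ℕ} {a₀ : 𝓢(Rn n, ℂ)} {b : 𝓢(Rn n, ℝ)}
    (hb : ∀ x, b x = ω * ‖a₀ x‖ ^ (2 * σ)) (h t : ℝ) (x : Rn n) :
    modulate b a₀ (t / h) x = odeFun ω σ h a₀ t x := by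
  rw [modulate_apply, phase, odeFun, hb, mul_comm]
  congr 2
  push_cast; ring

theorem toPhys_modulate {ω : ℝ} {σ : ℕ} {a₀ : 𝓢(Rn n, ℂ)} {b : 𝓢(Rn n, ℝ)}
    (hb : ∀ x, b x = ω * ‖a₀ x‖ ^ (2 * σ)) {k : ℝ} (hk : 0 ≤ k) (h t : ℝ) :
    toPhys hk (weighted n k (modulate b a₀ (t / h))) = odeSolution ω σ h a₀ t := by
  rw [toPhys_weighted]
  refine Lp.ext ?_
  filter_upwards [(modulate b a₀ (t / h)).coeFn_toLp 2 volume,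
    MemLp.coeFn_toLp (memLp_odeFun ω σ h a₀ t)] with x h1 h2
  rw [h1, odeSolution, h2, modulate_eq_odeFun hb]

theorem hasDerivAt_odeFun (ω : ℝ) (σ : ℕ) {h : ℝ} (hh : 0 < h) (a₀ : 𝓢(Rn n, ℂ)) (t : ℝ)
    (x : Rn n) :
    HasDerivAt (fun τ : ℝ => odeFun ω σ h a₀ τ x)
      (-(Complex.I * ω / h) * ((‖odeFun ω σ h a₀ t x‖ : ℂ) ^ (2 * σ) * odeFun ω σ h a₀ t x)) t := by
  obtain ⟨D, hD, he⟩ := odeFun_ode ω σ h hh.ne' a₀ t x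
  have hc : (h : ℂ) ≠ 0 := by exact_mod_cast hh.ne'
  convert hD using 1
  rw [← mul_right_inj' (mul_ne_zero Complex.I_ne_zero hc), he]
  field_simp
  linear_combination (-(ω : ℂ) * (‖odeFun ω σ h a₀ t x‖ : ℂ) ^ (2 * σ) * odeFun ω σ h a₀ t x) *
    Complex.I_sq

theorem continuous_odeFun (ω : ℝ) (σ : ℕ) (h : ℝ) (a₀ : 𝓢(Rn n, ℂ)) (t : ℝ) :
    Continuous (odeFun ω σ h a₀ t) := by
  unfold odeFun
  have := a₀.continuous
  fun_prop

/-- Differentiation under the integral; since `|φ| = |a₀|`, the majorant does not depend on time. -/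
theorem hasDerivAt_integral_odeFun (ω : ℝ) (σ : ℕ) {h : ℝ} (hh : 0 < h) (a₀ ψ : 𝓢(Rn n, ℂ))
    (t : ℝ) :
    HasDerivAt (fun τ : ℝ => ∫ x, odeFun ω σ h a₀ τ x * ψ x)
      (∫ x, -(Complex.I * ω / h) *
        ((‖odeFun ω σ h a₀ t x‖ : ℂ) ^ (2 * σ) * odeFun ω σ h a₀ t x) * ψ x) t := by
  set M := SchwartzMap.seminorm ℝ 0 0 a₀ with hM
  have hMa : ∀ x, ‖a₀ x‖ ≤ M := SchwartzMap.norm_le_seminorm ℝ a₀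
  refine (hasDerivAt_integral_of_dominated_loc_of_deriv_le (μ := volume) (s := univ)
    (bound := fun x => |ω| / h * (M ^ (2 * σ) * M) * ‖ψ x‖)
    (F := fun τ x => odeFun ω σ h a₀ τ x * ψ x)
    (F' := fun τ x => -(Complex.I * ω / h) *
        ((‖odeFun ω σ h a₀ τ x‖ : ℂ) ^ (2 * σ) * odeFun ω σ h a₀ τ x) * ψ x)
    univ_mem ?_ ?_ ?_ ?_ ?_ ?_).2
  · exact Eventually.of_forall fun τ =>
      ((continuous_odeFun ω σ h a₀ τ).mul ψ.continuous).aestronglyMeasurable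
  · exact (memLp_odeFun ω σ h a₀ t).integrable_mul (ψ.memLp 2 volume)
  · have := continuous_odeFun ω σ h a₀ t
    have := ψ.continuous
    exact Continuous.aestronglyMeasurable (by fun_prop)
  · refine Eventually.of_forall fun x τ _ => ?_
    rw [norm_mul, norm_mul, norm_mul, norm_pow, Complex.norm_real, norm_norm, norm_odeFun]
    have e : ‖(-(Complex.I * ω / h) : ℂ)‖ = |ω| / h := by simp [abs_of_pos hh]
    rw [e]
    have := hMa x
    gcongr
  · exact (ψ.integrable (μ := volume)).norm.const_mul _
  · exact Eventually.of_forall fun x τ _ => (hasDerivAt_odeFun ω σ hh a₀ τ x).mul_const (ψ x)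

/-- The interaction picture of `φ`, on weighted Fourier transforms. -/
noncomputable def approx (k h : ℝ) (b : 𝓢(Rn n, ℝ)) (a₀ : 𝓢(Rn n, ℂ)) (t : ℝ) : L2 n :=
  evol (freeSpeed h * t) (weighted n k (modulate b a₀ (t / h)))

/-- The error term of `approx` in the equation. -/
noncomputable def approxError (k h : ℝ) (b : 𝓢(Rn n, ℝ)) (a₀ : 𝓢(Rn n, ℂ)) (t : ℝ) : L2 n :=
  evol (freeSpeed h * t)
    ((Complex.I * (freeSpeed h : ℝ) : ℂ) • weightedNormSq n k (modulate b a₀ (t / h)))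

theorem hasDerivWithinAt_approx {k : ℝ} (hk : (n : ℝ) / 2 < k) {ω : ℝ} {σ : ℕ} {h : ℝ}
    (hh : 0 < h) {a₀ : 𝓢(Rn n, ℂ)} {b : 𝓢(Rn n, ℝ)} (hb : ∀ x, b x = ω * ‖a₀ x‖ ^ (2 * σ))
    (T : ℝ) :
    ∀ t ∈ Icc 0 T, HasDerivWithinAt (approx k h b a₀)
      (field hk ω σ h t (approx k h b a₀ t) + approxError k h b a₀ t) (Icc 0 T) t := by
  set hk0 := (nonneg_of_half_lt hk).le
  have hdiv : Continuous fun t : ℝ => t / h := by fun_prop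
  have hy : Continuous fun t => weighted n k (modulate b a₀ (t / h)) :=
    (continuous_modulate (weighted n k) b a₀).comp hdiv
  have hq : Continuous fun t => weightedNormSq n k (modulate b a₀ (t / h)) :=
    (continuous_modulate (weightedNormSq n k) b a₀).comp hdiv
  -- The equation of `φ` has no Laplacian, so the `|ξ|²` term is added here to compensate the one in
  -- `hasDerivWithinAt_evol_of_weak`; it becomes the error.
  have hR : Continuous fun t => scaledNonlin hk ω σ h (weighted n k (modulate b a₀ (t / h))) +
      (Complex.I * (freeSpeed h : ℝ) : ℂ) • weightedNormSq n k (modulate b a₀ (t / h)) :=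
    ((continuous_scaledNonlin hk ω σ hh).comp hy).add (hq.fun_const_smul _)
  intro t ht
  have key := hasDerivWithinAt_evol_of_weak hk0 (c := freeSpeed h) (T := T) hy.continuousOn
    hR.continuousOn (fun χ s hs => ?_) t ht
  · rw [field, approxError, ← map_add]
    simp only [approx, evol_neg_evol]
    exact key
  · have h1 := (hasDerivAt_integral_odeFun ω σ hh a₀ (𝓕 χ : 𝓢(Rn n, ℂ)) s).hasDerivWithinAt
      (s := Icc 0 T)
    have e1 : ∀ τ, ∫ x, odeFun ω σ h a₀ τ x * (𝓕 χ : 𝓢(Rn n, ℂ)) x =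
        pair (weighted n k (modulate b a₀ (τ / h))) (wtest hk0 χ) := by
      intro τ
      have := integral_toPhys_mul_eq_pair hk0 (weighted n k (modulate b a₀ (τ / h)))
        (𝓕 χ : 𝓢(Rn n, ℂ))
      rw [FourierTransform.fourierInv_fourier_eq] at this
      rw [← this, toPhys_modulate hb]
      refine integral_congr_ae ?_
      filter_upwards [MemLp.coeFn_toLp (memLp_odeFun ω σ h a₀ τ)] with x hx
      rw [odeSolution, hx]
    have e2 : ∫ x, -(Complex.I * ω / h) *
          ((‖odeFun ω σ h a₀ s x‖ : ℂ) ^ (2 * σ) * odeFun ω σ h a₀ s x) *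
            (𝓕 χ : 𝓢(Rn n, ℂ)) x =
        pair (scaledNonlin hk ω σ h (weighted n k (modulate b a₀ (s / h)))) (wtest hk0 χ) := by
      have := integral_nonlin_mul hk σ (weighted n k (modulate b a₀ (s / h)))
        (𝓕 χ : 𝓢(Rn n, ℂ))
      rw [FourierTransform.fourierInv_fourier_eq] at this
      rw [scaledNonlin, pair_smul_left, pair_wtest, ← this, toPhys_modulate hb,
        ← integral_const_mul]
      refine integral_congr_ae ?_
      filter_upwards [MemLp.coeFn_toLp (memLp_odeFun ω σ h a₀ s)] with x hx
      rw [odeSolution, hx]; ring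
    simp_rw [e1, e2] at h1
    refine h1.congr_deriv ?_
    rw [map_add, _root_.add_apply, pair_smul_left, pair_weightedNormSq]
    ring

theorem norm_approxError {k h : ℝ} (hh : 0 < h) (b : 𝓢(Rn n, ℝ)) (a₀ : 𝓢(Rn n, ℂ)) (t : ℝ) :
    ‖approxError k h b a₀ t‖ =
      2 * Real.pi ^ 2 * h * ‖weightedNormSq n k (modulate b a₀ (t / h))‖ := by
  rw [approxError, norm_evol, norm_smul, norm_mul, Complex.norm_I, one_mul, Complex.norm_real,
    freeSpeed, Real.norm_of_nonneg (by positivity)]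

/-! ### Comparison of the solutions -/

theorem toPhys_injective {k : ℝ} (hk : 0 ≤ k) :
    Function.Injective (toPhys hk : L2 n → L2 n) := by
  intro f g hfg
  have h := sobolevNorm_toPhys hk (f - g)
  rw [toPhys_sub, hfg, sub_self, ← sub_self (toPhys hk 0), ← toPhys_sub, sobolevNorm_toPhys,
    sub_self, enorm_zero] at h
  exact sub_eq_zero.1 (enorm_eq_zero.1 h.symm)

theorem odeSolution_zero (ω : ℝ) (σ : ℕ) (h : ℝ) (a₀ : 𝓢(Rn n, ℂ)) :
    odeSolution ω σ h a₀ 0 = a₀.toLp 2 := by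
  refine Lp.ext ?_
  filter_upwards [a₀.coeFn_toLp 2 volume, MemLp.coeFn_toLp (memLp_odeFun ω σ h a₀ 0)] with x h1 h2
  rw [h1, odeSolution, h2, odeFun_zero]

theorem toPhys_approx {ω : ℝ} {σ : ℕ} {a₀ : 𝓢(Rn n, ℂ)} {b : 𝓢(Rn n, ℝ)}
    (hb : ∀ x, b x = ω * ‖a₀ x‖ ^ (2 * σ)) {k : ℝ} (hk : 0 ≤ k) (h t : ℝ) :
    toPhys hk (evol (-(freeSpeed h * t)) (approx k h b a₀ t)) = odeSolution ω σ h a₀ t := by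
  rw [approx, evol_neg_evol, toPhys_modulate hb]

/-- Existence of a solution, and its distance to `φ`, in terms of bounds for `φ` in `Hᵏ` and
`Hᵏ⁺²`. -/
theorem exists_solution_and_norm_sub_le {k : ℝ} (hk : (n : ℝ) / 2 < k) {ω : ℝ} {σ : ℕ} {h : ℝ}
    (hh : 0 < h) {a₀ : 𝓢(Rn n, ℂ)} {b : 𝓢(Rn n, ℝ)} (hb : ∀ x, b x = ω * ‖a₀ x‖ ^ (2 * σ))
    {T P ε K : ℝ} (hT : 0 ≤ T) (hP : 0 ≤ P) (hε : 0 ≤ ε)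
    (hK : |ω| / h * ((2 * σ + 1) * (prodConst n k * (P + 1)) ^ (2 * σ)) ≤ K)
    (hp : ∀ t ∈ Icc 0 T, ‖weighted n k (modulate b a₀ (t / h))‖ ≤ P)
    (he : ∀ t ∈ Icc 0 T,
      2 * Real.pi ^ 2 * h * ‖weightedNormSq n k (modulate b a₀ (t / h))‖ ≤ ε)
    (hsmall : ε * T * Real.exp (2 * K * T) ≤ 1) :
    (∃ u : ℝ → L2 n, IsNLSSolution k ω σ h T a₀ u) ∧
      ∀ u : ℝ → L2 n, IsNLSSolution k ω σ h T a₀ u → ∀ t ∈ Icc 0 T,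
        sobolevNorm k (u t - odeSolution ω σ h a₀ t) ≤
          ENNReal.ofReal (ε * T * Real.exp (2 * K * T)) := by
  have hk0 := (nonneg_of_half_lt hk).le
  have hA := prodConst_nonneg (n := n) k
  have hK0 : 0 ≤ K := le_trans (by positivity) hK
  obtain ⟨v, hv0, hv⟩ := exists_ode_solution_near (f := field hk ω σ h) (K := K.toNNReal)
    (p := approx k h b a₀) (e := approxError k h b a₀) hT hP hε (field_zero hk ω σ h)
    (continuous_field hk ω σ hh)
    (fun t x y hx hy => (norm_field_sub_le hk ω σ hh t hx hy).trans (by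
      rw [Real.coe_toNNReal _ hK0]; gcongr))
    (hasDerivWithinAt_approx hk hh hb T)
    (fun t ht => by rw [approx, norm_evol]; exact hp t ht)
    (fun t ht => by rw [norm_approxError hh]; exact he t ht)
    (by rwa [Real.coe_toNNReal _ hK0])
  rw [Real.coe_toNNReal _ hK0] at hv
  have hv0' : toPhys hk0 (v 0) = a₀.toLp 2 := by
    have := toPhys_approx hb hk0 h 0
    rwa [mul_zero, neg_zero, evol_zero, odeSolution_zero, ← hv0] at this
  refine ⟨⟨_, isNLSSolution_of_hasDerivWithinAt hk hh hv0' fun t ht => (hv t ht).1⟩,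
    fun u hu t ht => ?_⟩
  obtain ⟨w, hwu, hw⟩ := hu.exists_hasDerivWithinAt hk hh
  have hw0 : w 0 = v 0 := by
    refine toPhys_injective hk0 ?_
    have := hwu 0 (left_mem_Icc.2 hT)
    rw [mul_zero, neg_zero, evol_zero, hu.initial] at this
    rw [this, hv0']
  have hwv : w t = v t := by
    refine ode_solution_unique_of_lipschitz_on_balls (fun R hR => ?_) hw (fun s hs => (hv s hs).1)
      hw0 ht
    refine ⟨(|ω| / h * ((2 * σ + 1) * (prodConst n k * R) ^ (2 * σ))).toNNReal,
      fun s x y hx hy => ?_⟩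
    rw [Real.coe_toNNReal _ (by positivity)]
    exact norm_field_sub_le hk ω σ hh s hx hy
  rw [← hwu t ht, hwv, ← toPhys_approx hb hk0, ← toPhys_sub, sobolevNorm_toPhys, ← map_sub,
    ← ofReal_norm, norm_evol]
  exact ENNReal.ofReal_le_ofReal (hv t ht).2

/-! ### Elementary bounds involving `log h` -/

theorem mul_exp_half_abs_log_le {h : ℝ} (hh : 0 < h) (hh1 : h ≤ 1) :
    h * Real.exp (|Real.log h| / 2) ≤ 1 := by
  have hl := Real.log_nonpos hh.le hh1
  calc h * Real.exp (|Real.log h| / 2) = Real.exp (Real.log h) * Real.exp (|Real.log h| / 2) := by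
        rw [Real.exp_log hh]
    _ = Real.exp (Real.log h / 2) := by
        rw [← Real.exp_add, abs_of_nonpos hl]; congr 1; ring
    _ ≤ 1 := Real.exp_le_one_iff.2 (by linarith)

/-- Half a power of `h` absorbs the logarithm, `√h |log h| ≤ 2`, and the other half absorbs `2A`. -/
theorem mul_abs_log_le {h A : ℝ} (hA : 0 < A) (hh : 0 < h) (hh1 : h ≤ 1)
    (hhA : h ≤ 1 / (4 * A ^ 2)) : A * (h * |Real.log h|) ≤ 1 := by
  have h1 := Real.abs_log_mul_self_rpow_lt h (1 / 2) hh hh1 (by norm_num)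
  rw [← Real.sqrt_eq_rpow, abs_mul, abs_of_nonneg (Real.sqrt_nonneg h)] at h1
  have h2 : Real.sqrt h ≤ 1 / (2 * A) := by
    refine Real.sqrt_le_iff.2 ⟨by positivity, hhA.trans (le_of_eq ?_)⟩
    field_simp; norm_num
  have h3 : 0 ≤ Real.sqrt h := Real.sqrt_nonneg h
  calc A * (h * |Real.log h|) = A * (Real.sqrt h * (|Real.log h| * Real.sqrt h)) := by
        nth_rewrite 1 [← Real.mul_self_sqrt hh.le]; ring
    _ ≤ A * (1 / (2 * A) * 2) := by
        gcongr; exact h1.le.trans (by norm_num)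
    _ = 1 := by field_simp

end SemiclassicalNLS

/-! ### Choice of the constants -/

open SemiclassicalNLS

theorem proposition2p1 (n : ℕ) (hn : 1 ≤ n) (ω : ℝ) (hω : ω ≠ 0) (σ : ℕ) (hσ : 0 < σ)
    (a₀ : 𝓢(SemiclassicalNLS.Rn n, ℂ)) (k : ℝ) (hk : (n : ℝ) / 2 < k) :
    ∃ c₀ > (0 : ℝ), ∃ c₁ > (0 : ℝ), ∃ θ > (0 : ℝ), ∃ C > (0 : ℝ), ∃ h₀ ∈ Set.Ioo (0 : ℝ) 1,
      ∀ h ∈ Set.Ioc 0 h₀,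
        (∃ u : ℝ → SemiclassicalNLS.L2 n,
          SemiclassicalNLS.IsNLSSolution k ω σ h (c₀ * h * |Real.log h| ^ θ) a₀ u) ∧
        ∀ u : ℝ → SemiclassicalNLS.L2 n,
          SemiclassicalNLS.IsNLSSolution k ω σ h (c₀ * h * |Real.log h| ^ θ) a₀ u →
          ∀ t ∈ Set.Icc 0 (c₀ * h * |Real.log h| ^ θ),
            SemiclassicalNLS.sobolevNorm k (u t - SemiclassicalNLS.odeSolution ω σ h a₀ t) ≤
              ENNReal.ofReal (C * h * |Real.log h| ^ c₁) := by
  obtain ⟨b, hb⟩ := exists_potential ω hσ a₀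
  obtain ⟨N₁, C₁, hC₁, h₁⟩ := exists_norm_modulate_le (weighted n k) b a₀
  obtain ⟨N₂, C₂, hC₂, h₂⟩ := exists_norm_modulate_le (weightedNormSq n k) b a₀
  have ha := prodConst_nonneg (n := n) k
  set A : ℝ := 1 + C₁ * 2 ^ N₁ + 2 * Real.pi ^ 2 * (C₂ * 2 ^ N₂) with hA
  have hA1 : 1 ≤ A := by rw [hA, add_assoc]; exact le_add_of_nonneg_right (by positivity)
  have hA₁ : C₁ * 2 ^ N₁ ≤ A := by
    have : 0 ≤ 2 * Real.pi ^ 2 * (C₂ * 2 ^ N₂) := by positivity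
    linarith
  have hA₂ : 2 * Real.pi ^ 2 * (C₂ * 2 ^ N₂) ≤ A := by
    have : 0 ≤ C₁ * 2 ^ N₁ := by positivity
    linarith
  -- A common exponent for the growth of `φ` in `Hᵏ` and `Hᵏ⁺²`.
  set M : ℕ := N₁ + N₂ + 1 with hM
  set B : ℝ := 1 + |ω| * ((2 * σ + 1) * (prodConst n k * (2 * A)) ^ (2 * σ)) with hB
  have hB1 : 1 ≤ B := le_add_of_nonneg_right (by positivity)
  -- The power of `Y = |log h|^θ` in Lipschitz constant times time: `2σM` from the nonlinearity on a
  -- ball of radius of order `Y^M`, and one from the length of the interval. Hence `θ = 1/E`.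
  set E : ℕ := 2 * σ * M + 1 with hE
  have hE0 : (0 : ℝ) < E := by rw [hE]; positivity
  refine ⟨1 / (4 * B), by positivity, (E : ℝ)⁻¹ * (M + 1 : ℕ), by positivity, (E : ℝ)⁻¹,
    by positivity, A, by linarith, min (Real.exp (-1)) (1 / (4 * A ^ 2)), ⟨by positivity,
    (min_le_left _ _).trans_lt ((Real.exp_lt_exp.2 (by norm_num)).trans_eq Real.exp_zero)⟩, fun h hh => ?_⟩
  have hh0 : 0 < h := hh.1
  have hhe : h ≤ Real.exp (-1) := hh.2.trans (min_le_left _ _)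
  have hh1 : h ≤ 1 := hhe.trans (Real.exp_le_one_iff.2 (by norm_num))
  have hhA : h ≤ 1 / (4 * A ^ 2) := hh.2.trans (min_le_right _ _)
  set l : ℝ := |Real.log h| with hl
  have hl1 : 1 ≤ l := by
    have := (Real.log_le_iff_le_exp hh0).2 hhe
    -- The cutoff `h ≤ exp(-1)` gives `|log h| ≥ 1`, so larger powers of `Y` dominate smaller ones.
    rw [hl, abs_of_nonpos (by linarith)]; linarith
  have hl0 : 0 ≤ l := by linarith
  set Y : ℝ := l ^ ((E : ℝ)⁻¹) with hY
  have hY1 : 1 ≤ Y := Real.one_le_rpow hl1 (by positivity)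
  have hYE : Y ^ E = l := Real.rpow_inv_natCast_pow hl0 (by omega)
  have hYM : l ^ ((E : ℝ)⁻¹ * (M + 1 : ℕ)) = Y ^ (M + 1) := Real.rpow_mul_natCast hl0 _ _
  have hYl : Y ^ (M + 1) ≤ l := by
    rw [← hYE]
    -- Here `σ ≥ 1` gives `M + 1 ≤ E`.
    refine pow_le_pow_right₀ hY1 ?_
    rw [hE]
    nlinarith
  have hc₀ : 1 / (4 * B) ≤ 1 := by rw [div_le_one (by positivity)]; linarith
  have hpow : ∀ {N : ℕ} {t : ℝ}, N ≤ M → t ∈ Icc 0 (1 / (4 * B) * h * Y) →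
      (1 + |t / h|) ^ N ≤ 2 ^ N * Y ^ M := by
    intro N t hN ht
    have h3 : |t / h| ≤ Y := by
      rw [abs_of_nonneg (div_nonneg ht.1 hh0.le), div_le_iff₀ hh0]
      calc t ≤ 1 / (4 * B) * h * Y := ht.2
        _ ≤ 1 * h * Y := by gcongr
        _ = Y * h := by ring
    calc (1 + |t / h|) ^ N ≤ (2 * Y) ^ N := by gcongr; linarith
      _ = 2 ^ N * Y ^ N := mul_pow _ _ _
      _ ≤ _ := by gcongr
  have hT0 : 0 ≤ 1 / (4 * B) * h * Y := by positivity
  -- The value `c₀ = 1/(4B)` is tuned so that the Gronwall factor is `h^(-1/2)`; one factor `h` of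
  -- the error more than compensates for it.
  have hexp : 2 * (B * Y ^ (2 * σ * M) / h) * (1 / (4 * B) * h * Y) = l / 2 := by
    rw [← hYE, hE, pow_succ]; field_simp; ring
  have hfin : h * A * Y ^ M * (1 / (4 * B) * h * Y) *
      Real.exp (2 * (B * Y ^ (2 * σ * M) / h) * (1 / (4 * B) * h * Y)) ≤ A * h * Y ^ (M + 1) := by
    rw [hexp]
    calc _ = A * h * Y ^ (M + 1) * ((1 / (4 * B)) * (h * Real.exp (l / 2))) := by ring
      _ ≤ A * h * Y ^ (M + 1) * (1 * 1) := by
          gcongr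
          exact mul_exp_half_abs_log_le hh0 hh1
      _ = _ := by ring
  have key := exists_solution_and_norm_sub_le hk hh0 hb (T := 1 / (4 * B) * h * Y)
    (P := A * Y ^ M) (ε := h * A * Y ^ M) (K := B * Y ^ (2 * σ * M) / h) hT0 (by positivity)
    (by positivity) ?_ ?_ ?_ ?_
  · refine ⟨key.1, fun u hu t ht => (key.2 u hu t ht).trans (ENNReal.ofReal_le_ofReal ?_)⟩
    rw [hYM]
    exact hfin
  · rw [div_mul_eq_mul_div]
    refine div_le_div_of_nonneg_right ?_ hh0.le
    have hP1 : A * Y ^ M + 1 ≤ 2 * A * Y ^ M := by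
      have : 1 ≤ A * Y ^ M := one_le_mul_of_one_le_of_one_le hA1 (one_le_pow₀ hY1)
      linarith
    calc |ω| * ((2 * σ + 1) * (prodConst n k * (A * Y ^ M + 1)) ^ (2 * σ))
        ≤ |ω| * ((2 * σ + 1) * (prodConst n k * (2 * A * Y ^ M)) ^ (2 * σ)) := by gcongr
      _ = |ω| * ((2 * σ + 1) * (prodConst n k * (2 * A)) ^ (2 * σ)) * Y ^ (2 * σ * M) := by
          rw [← mul_assoc (prodConst n k), mul_pow _ (Y ^ M), ← pow_mul, mul_comm M]; ring
      _ ≤ B * Y ^ (2 * σ * M) := by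
          gcongr; rw [hB]; linarith
  · intro t ht
    calc _ ≤ C₁ * (1 + |t / h|) ^ N₁ := h₁ _
      _ ≤ C₁ * (2 ^ N₁ * Y ^ M) := by gcongr; exact hpow (by omega) ht
      _ = C₁ * 2 ^ N₁ * Y ^ M := by ring
      _ ≤ _ := by gcongr
  · intro t ht
    calc _ ≤ 2 * Real.pi ^ 2 * h * (C₂ * (2 ^ N₂ * Y ^ M)) := by
          gcongr
          exact (h₂ _).trans (by gcongr; exact hpow (by omega) ht)
      _ = h * (2 * Real.pi ^ 2 * (C₂ * 2 ^ N₂)) * Y ^ M := by ring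
      _ ≤ _ := by gcongr
  -- The smallness that keeps the solution in the ball of radius `P + 1`; the second bound on `h₀`
  -- serves only this.
  · refine hfin.trans ?_
    calc A * h * Y ^ (M + 1) ≤ A * h * l := by gcongr
      _ = A * (h * l) := by ring
      _ ≤ 1 := mul_abs_log_le (by linarith) hh0 hh1 hhA
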